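/- **Definitions.** Let $p=(p_0,p_1)$ with $p_0,p_1>0$ and $p_0+p_1=1$, let $\sigma^2>0$ and let $c=(c_1,c_2,c_3)$ be positive reals. A *$(p,\sigma^2,c)$-discrete normal family* is a family $(\mathcal N^t)_{t\ge 1}$ of probability distributions on $\mathbb Z$ (with finite second moment) such that for every integer $t\ge 1$: 1. $\mathbb E[\mathcal N^t]=p_1t$; 2. $|\operatorname{Var}(\mathcal N^t)-\sigma^2t|\le c_1\,|\sigma^2-p_0p_1|$; 3. $\mathcal N^1=\mathrm{Bern}(p)$, i.e. it takes the values $1$ and $0$ with probabilities $p_1$ and $p_0$; 4. for all positive integers $\ell\le t$ and $t_0,\dots,t_{\ell-1}$ with $\sum_i t_i=t$, $$d_{\mathrm{TV}}\Big(\sum_{i=0}^{\ell-1}\mathcal N^{t_i},\ \mathcal N^t\Big)\le \frac{c_2}{2}\cdot\frac{(\ell-1)\,|\sigma^2/(p_0p_1)-1|}{t},$$ where the summands are independent and $d_{\mathrm{TV}}$ is half the $\ell^1$ distance of the probability mass functions; 5. for all real $a\ge 0$, $$\sum_{j\in\mathbb Z:\,|j-p_1t|\ge a}\big|\Pr[\mathcal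 N^t=j]-\Pr[\mathrm{Bin}(t,p_1)=j]\big|\le c_3\,|\sigma^2/(p_0p_1)-1|\,e^{-a^2/(8t)};$$ 6. $|\mathbb E[e^{-i\theta\mathcal N^t}]|\le e^{-p_0p_1t\theta^2/20}$ for all $-\pi\le\theta\le\pi$. The *two-state $\lambda$-sticky, $p$-biased random walk* is the Markov chain on $\{0,1\}$ with initial distribution $p$ and transition probabilities (column = current state, row = next state) $$\begin{pmatrix}p_0+p_1\lambda & p_0-p_0\lambda\\ p_1-p_1\lambda & p_1+p_0\lambda\end{pmatrix}.$$ More generally, let $V$ be a finite nonempty vertex set with a labeling $\mathrm{val}:V\to\{0,1\}$, let $V_b=\mathrm{val}^{-1}(b)$, and suppose $|V_b|/|V|=p_b$ for $b=0,1$. The *$\lambda$-sticky, $p$-biased random walk matrix* $G_{\lambda,p}$ on $V$ has as its entry in row $v'$ and column $v$ the above probability of moving from $\mathrm{val}(v)$ to $\mathrm{val}(v')$, divided by $|V_{\mathrm{val}(v')}|$. For a random walk matrix $W$ on $V$ (entries in $[0,1]$, columns summing to $1$), $\Sigma\mathrm{val}(\mathrm{RW}_W^t)$ denotes the distribution of $\sum_{i=0}^{t-1}\mathrm{val}(v_i)$,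 where $v_0$ is uniform on $V$ and $\Pr[v_i=v'\mid v_{i-1}=v]=W_{v',v}$. **Proposition 2.9.** Let $p=(p_0,p_1)$ with $p_0,p_1>0$, $p_0+p_1=1$, put $m=\min\{p_0/p_1,\ p_1/p_0,\ 1/100\}$, and let $$\frac{1-m}{1+m}\,p_0p_1\ \le\ \sigma^2\ \le\ \frac{1+\frac1{100}}{1-\frac1{100}}\,p_0p_1 .$$ Then there exists a $(p,\sigma^2,c)$-discrete normal family $(\mathcal N^t)_t$ with $c_1=2$, $c_2=2020$, $c_3=2020$. Specifically, with $\lambda=(\sigma^2-p_0p_1)/(\sigma^2+p_0p_1)$, such a family is given by the distribution $\mathcal N^t$ of the sum of the first $t$ states of the two-state $\lambda$-sticky, $p$-biased random walk, whose transition matrix is indeed a random walk matrix. Moreover, for every finite vertex set $V$ with a labeling of label weights $p$, the matrix $G_{\lambda,p}$ is a random walk matrix on $V$ and $\mathcal N^t=\Sigma\mathrm{val}(\mathrm{RW}_{G_{\lambda,p}}^t)$ for all $t$. -/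

import Mathlib

open MeasureTheory ProbabilityTheory
open scoped unitInterval

noncomputable section

/-! ### Discrete normal families -/

/-- Total variation distance between two probability distributions on `ℤ`: half of the
`ℓ¹` distance of their probability mass functions. -/
def tvDist (μ ν : Measure ℤ) : ℝ :=
  (1 / 2) * ∑' j : ℤ, |μ.real {j} - ν.real {j}|

/-- The distribution of `∑ i, X i` where the `X i` are independent and `X i` has law `μ i`. -/
def indepSum {ℓ : ℕ} (μ : Fin ℓ → Measure ℤ) : Measure ℤ :=
  (Measure.pi μ).map (fun x => ∑ i, x i)

/-- `(p, σ², c)`-discrete normal families, for `p = (p₀, p₁)` and `c = (c₁, c₂, c₃)`.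
The distribution `N t` is used for positive integers `t`. -/
structure IsDiscreteNormalFamily (p₀ p₁ : I) (σsq c₁ c₂ c₃ : ℝ) (N : ℕ → Measure ℤ) :
    Prop where
  isProbabilityMeasure : ∀ t : ℕ, 1 ≤ t → IsProbabilityMeasure (N t)
  /-- The mean and the variance exist. -/
  memLp : ∀ t : ℕ, 1 ≤ t → MemLp (fun j : ℤ => (j : ℝ)) 2 (N t)
  mean : ∀ t : ℕ, 1 ≤ t → ∫ j : ℤ, (j : ℝ) ∂(N t) = p₁ * t
  variance : ∀ t : ℕ, 1 ≤ t →
    |ProbabilityTheory.variance (fun j : ℤ => (j : ℝ)) (N t) - σsq * t|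
      ≤ c₁ * |σsq - p₀ * p₁|
  /-- `N 1` gives mass `p₁` to `1` and mass `1 - p₁` to `0`. -/
  bernoulli : N 1 = bernoulliMeasure (1 : ℤ) 0 p₁
  indep_sum : ∀ t : ℕ, 1 ≤ t → ∀ (ℓ : ℕ) (s : Fin ℓ → ℕ), 1 ≤ ℓ → ℓ ≤ t →
    (∀ i, 1 ≤ s i) → ∑ i, s i = t →
    tvDist (indepSum fun i => N (s i)) (N t)
      ≤ c₂ / 2 * ((((ℓ : ℝ) - 1) * |σsq / (p₀ * p₁) - 1|) / t)
  tail : ∀ t : ℕ, 1 ≤ t → ∀ a : ℝ, 0 ≤ a →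
    ∑' j : {j : ℤ // a ≤ |(j : ℝ) - p₁ * t|},
        |(N t).real {(j : ℤ)} - ((binomial t p₁).map (Nat.cast : ℕ → ℤ)).real {(j : ℤ)}|
      ≤ c₃ * |σsq / (p₀ * p₁) - 1| * Real.exp (-a ^ 2 / (8 * t))
  fourier : ∀ t : ℕ, 1 ≤ t → ∀ θ : ℝ, |θ| ≤ Real.pi →
    ‖∫ j : ℤ, Complex.exp (-(Complex.I * θ * j)) ∂(N t)‖
      ≤ Real.exp (-(p₀ * p₁ * t * θ ^ 2) / 20)

/-! ### Random walks -/

section RandomWalk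

variable {V : Type*} [Fintype V]

/-- Random walk matrices on `V`: the entry `W v' v` is the transition probability
from `v` to `v'`, so the columns sum to `1`. -/
def IsRandomWalkMatrix (W : Matrix V V ℝ) : Prop :=
  (∀ v' v, W v' v ∈ Set.Icc (0 : ℝ) 1) ∧ ∀ v, ∑ v', W v' v = 1

/-- The distribution of the vertex following `v`. -/
def stepLaw (W : Matrix V V ℝ) (hW : IsRandomWalkMatrix W) (v : V) : PMF V :=
  PMF.ofFintype (fun v' => ENNReal.ofReal (W v' v)) (by
    rw [← ENNReal.ofReal_sum_of_nonneg fun v' _ => (hW.1 v' v).1, hW.2 v, ENNReal.ofReal_one])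

/-- The distribution of the random walk `(v_0, …, v_{t-1})` of length `t` with transition
matrix `W`, whose first vertex has law `init`. -/
def walkLaw (init : PMF V) (W : Matrix V V ℝ) (hW : IsRandomWalkMatrix W) :
    (t : ℕ) → PMF (Fin t → V)
  | 0 => PMF.pure Fin.elim0
  | 1 => init.map fun v _ => v
  | t + 2 => (walkLaw init W hW (t + 1)).bind fun v =>
      (stepLaw W hW (v (Fin.last t))).map fun w => Fin.snoc v w

/-- The distribution of the sum of the labels along a random walk of length `t`. -/
def labelSumLaw (init : PMF V) (W : Matrix V V ℝ) (hW : IsRandomWalkMatrix W)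
    (val : V → Fin 2) (t : ℕ) : Measure ℤ :=
  ((walkLaw init W hW t).map fun v => ∑ i, ((val (v i) : ℕ) : ℤ)).toMeasure

end RandomWalk

/-! ### Sticky walks -/

/-- The transition matrix of the `lam`-sticky, `p`-biased walk between the two label classes;
the `(b', b)` entry is the probability of moving from label `b` to label `b'`. -/
def stickyTransition (p₀ p₁ lam : ℝ) : Matrix (Fin 2) (Fin 2) ℝ :=
  !![p₀ + p₁ * lam, p₀ - p₀ * lam;
     p₁ - p₁ * lam, p₁ + p₀ * lam]

/-- The distribution on `{0, 1}` giving mass `p₁` to `1` and `1 - p₁` to `0`. -/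
def labelLaw (p₁ : I) : PMF (Fin 2) :=
  PMF.ofFintype ![ENNReal.ofReal (1 - p₁), ENNReal.ofReal p₁] (by
    rw [Fin.sum_univ_two]
    simp only [Matrix.cons_val_zero, Matrix.cons_val_one]
    rw [← ENNReal.ofReal_add (sub_nonneg.2 p₁.2.2) p₁.2.1, sub_add_cancel, ENNReal.ofReal_one])

section StickyMatrix

variable {V : Type*} [Fintype V]

/-- The number of vertices with label `b`. -/
def labelCard (val : V → Fin 2) (b : Fin 2) : ℕ :=
  (Finset.univ.filter fun v => val v = b).card

/-- The fraction of vertices with label `b`. -/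
def labelWeight (val : V → Fin 2) (b : Fin 2) : ℝ :=
  (labelCard val b : ℝ) / (Fintype.card V : ℝ)

/-- The `lam`-sticky, `p`-biased random walk matrix on a vertex set `V = V_0 ⊔ V_1`, where `V_b`
is the set of vertices labelled `b` and `p_b` is its weight. Its `V_{b'} × V_b` block is
constant, equal to the transition probability from `V_b` to `V_{b'}` divided by `|V_{b'}|`. -/
def stickyMatrix (val : V → Fin 2) (lam : ℝ) : Matrix V V ℝ := fun v' v =>
  stickyTransition (labelWeight val 0) (labelWeight val 1) lam (val v') (val v)
    * (1 / (labelCard val (val v') : ℝ))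

end StickyMatrix

end

/-! ### Weighted ℓ¹ norms of polynomials -/

section WeightedNorm

open Polynomial

/-! Write B = p + qX, Δ = pq(1 − X)², and let F_t be the generating function of the label sum of a
walk of length t. Conditioning on the initial label gives F_{t+1} = B F_t + λΔD_t and D_{t+1} = F_t
+ λ(q + pX)D_t, where (1 − X)D_t is the difference of the two conditional generating functions.
Every deviation from independence carries a factor λ and a second difference Δ: cutting a walk in
two costs exactly λΔD_sD_u (`walkPoly_add`), and F_t − B^t = λ∑ D_{t−1−j}ΔB^j
(`walkPoly_succ_sub_pow`). The splitting and tail bounds therefore reduce to showing that such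
second differences have weighted ℓ¹ norm O(1/t).

For Δ^m B^a, Cauchy–Schwarz against the binomial weight and the orthogonality of Krawtchouk
polynomials give the bound κ^{a+2m} 2^m / C(a+m, m) with κ² = p + qr². The reciprocal binomial
coefficient is a Beta integral, so up to a factor linear in the degree B may be replaced by x and Δ
by 2(1 − x), integrated over [0, 1] (`Dominated`). The recurrence becomes a scalar one; for |λ| ≤
1/100 it is solved by ((1+x)/2)^t for F_t and 2((1+x)/2)^t for D_{t+1} (`Dominated.walkPoly_mul`).
Since ∫ ((1+x)/2)^n · 2(1−x) is O(1/n²), the second differences are O(1/n). Taking r = e^h gives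
Gaussian tails by the exponential Markov inequality.

Mean and variance are computed exactly from derivatives at 1. On the unit circle |B|² = 1 − s with s
= |Δ|, and the energy |F|² + s|D|²/2 contracts by 1 − s/4 per step, which is the Fourier bound.
Finally, the labels of a walk driven by G_{λ,p} form the two-state chain, so all these walks share
one label sum law. -/

/-- The generating function `p + q X`. -/
noncomputable def bernPoly (p q : ℝ) : ℝ[X] := C p + C q * X

/-- The weighted `ℓ¹` norm `∑ j, |f_j| r ^ j` of a polynomial. -/
noncomputable def wnorm (r : ℝ) (f : ℝ[X]) : ℝ := f.sum fun j a => |a| * r ^ j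

lemma wnorm_eq_sum {r : ℝ} {f : ℝ[X]} {N : ℕ} (hN : f.natDegree < N) :
    wnorm r f = ∑ j ∈ Finset.range N, |f.coeff j| * r ^ j :=
  f.sum_over_range' (by simp) N hN

lemma wnorm_nonneg {r : ℝ} (hr : 0 ≤ r) (f : ℝ[X]) : 0 ≤ wnorm r f :=
  Finset.sum_nonneg fun _ _ => mul_nonneg (abs_nonneg _) (pow_nonneg hr _)

lemma wnorm_add_le {r : ℝ} (hr : 0 ≤ r) (f g : ℝ[X]) :
    wnorm r (f + g) ≤ wnorm r f + wnorm r g := by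
  set N := max f.natDegree g.natDegree + 1
  have h1 : f.natDegree < N := Nat.lt_succ_of_le (le_max_left _ _)
  have h2 : g.natDegree < N := Nat.lt_succ_of_le (le_max_right _ _)
  have h3 : (f + g).natDegree < N := Nat.lt_succ_of_le (natDegree_add_le f g)
  rw [wnorm_eq_sum h1, wnorm_eq_sum h2, wnorm_eq_sum h3, ← Finset.sum_add_distrib]
  refine Finset.sum_le_sum fun j _ => ?_
  rw [coeff_add, ← add_mul]
  exact mul_le_mul_of_nonneg_right (abs_add_le _ _) (pow_nonneg hr _)

lemma wnorm_zero (r : ℝ) : wnorm r 0 = 0 := by simp [wnorm]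

lemma wnorm_C_mul (r a : ℝ) (f : ℝ[X]) : wnorm r (C a * f) = |a| * wnorm r f := by
  have h1 : f.natDegree < f.natDegree + 1 := Nat.lt_succ_self _
  have h2 : (C a * f).natDegree < f.natDegree + 1 :=
    Nat.lt_succ_of_le (natDegree_C_mul_le a f)
  rw [wnorm_eq_sum h1, wnorm_eq_sum h2, Finset.mul_sum]
  refine Finset.sum_congr rfl fun j _ => ?_
  rw [coeff_C_mul, abs_mul, mul_assoc]

lemma wnorm_X_mul (r : ℝ) (f : ℝ[X]) : wnorm r (X * f) = r * wnorm r f := by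
  have h1 : f.natDegree < f.natDegree + 1 := Nat.lt_succ_self _
  have h2 : (X * f).natDegree < f.natDegree + 1 + 1 := by
    refine Nat.lt_succ_of_le (natDegree_mul_le.trans ?_)
    rw [natDegree_X, add_comm]
  rw [wnorm_eq_sum h1, wnorm_eq_sum h2, Finset.mul_sum, Finset.sum_range_succ']
  simp only [coeff_X_mul, mul_coeff_zero, coeff_X_zero, zero_mul, abs_zero, add_zero]
  refine Finset.sum_congr rfl fun j _ => by ring

lemma wnorm_bernPoly_mul_le {r p q : ℝ} (hr : 0 ≤ r) (hp : 0 ≤ p) (hq : 0 ≤ q) (f : ℝ[X]) :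
    wnorm r (bernPoly p q * f) ≤ (p + q * r) * wnorm r f := by
  rw [bernPoly, add_mul, mul_assoc]
  refine (wnorm_add_le hr _ _).trans ?_
  rw [wnorm_C_mul, wnorm_C_mul, wnorm_X_mul, abs_of_nonneg hp, abs_of_nonneg hq]
  linarith

lemma wnorm_sum_le {r : ℝ} (hr : 0 ≤ r) {ι : Type*} (s : Finset ι) (f : ι → ℝ[X]) :
    wnorm r (∑ i ∈ s, f i) ≤ ∑ i ∈ s, wnorm r (f i) := by
  classical
  induction s using Finset.induction_on with
  | empty => simp [wnorm_zero]
  | insert a s ha ih =>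
    rw [Finset.sum_insert ha, Finset.sum_insert ha]
    linarith [wnorm_add_le hr (f a) (∑ i ∈ s, f i)]

/-! ### Krawtchouk polynomials and second differences of binomial laws -/

lemma coeff_linear_pow {R : Type*} [CommRing R] (a b : R) (N j : ℕ) :
    ((C a + C b * X) ^ N).coeff j = N.choose j * (b ^ j * a ^ (N - j)) := by
  rw [add_comm, add_pow, finsetSum_coeff]
  have : ∀ m ∈ Finset.range (N + 1),
      ((C b * X) ^ m * C a ^ (N - m) * (N.choose m : R[X])).coeff j
        = if m = j then (N.choose j * (b ^ j * a ^ (N - j)) : R) else 0 := by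
    intro m _
    have e : (C b * X) ^ m * C a ^ (N - m) * (N.choose m : R[X])
        = C (b ^ m * a ^ (N - m) * N.choose m) * X ^ m := by
      simp only [map_mul, map_pow, map_natCast]; ring
    rw [e, coeff_C_mul, coeff_X_pow]
    by_cases h : m = j
    · subst h; simp; ring
    · simp [h, Ne.symm h]
  rw [Finset.sum_congr rfl this, Finset.sum_ite_eq']
  split_ifs with h
  · rfl
  · rw [Nat.choose_eq_zero_of_lt (by simpa using h)]; simp

/-- The coefficients of `(1 - X) ^ k (p + q X) ^ (N - k)` (Krawtchouk polynomials times a binomial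
distribution), through their generating function in `k`. -/
lemma choose_mul_coeff_krawtchouk {p q : ℝ} (N j k : ℕ) :
    (N.choose k : ℝ) * ((1 - X) ^ k * bernPoly p q ^ (N - k)).coeff j
      = (C (N.choose j : ℝ) * ((C q - X) ^ j * (C p + X) ^ (N - j))).coeff k := by
  -- With Y the inner variable, (p + Y) + (q − Y)X = Y(1 − X) + (p + qX); the N-th powers of both
  -- sides are expanded and the coefficients of X^j Y^k compared.
  have h : (C (C p + X) + C (C q - X) * X : ℝ[X][X]) ^ N
      = ∑ m ∈ Finset.range (N + 1),
        C (X ^ m) * (((1 - X) ^ m * bernPoly p q ^ (N - m)).map C) * (N.choose m : ℝ[X][X]) := by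
    have e : (C (C p + X) + C (C q - X) * X : ℝ[X][X])
        = C X * ((1 - X : ℝ[X]).map C) + (bernPoly p q).map C := by
      simp [bernPoly]; ring
    rw [e, add_pow]
    refine Finset.sum_congr rfl fun m _ => ?_
    simp only [Polynomial.map_mul, Polynomial.map_pow, map_pow]
    ring
  have h2 := congrArg (fun P : ℝ[X][X] => (P.coeff j).coeff k) h
  simp only [coeff_linear_pow, finsetSum_coeff] at h2
  have e : ∀ m ∈ Finset.range (N + 1),
      ((C (X ^ m) * (((1 - X) ^ m * bernPoly p q ^ (N - m)).map C)
        * (N.choose m : ℝ[X][X])).coeff j).coeff k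
      = if m = k then (N.choose k * ((1 - X) ^ k * bernPoly p q ^ (N - k)).coeff j : ℝ) else 0 := by
    intro m _
    have e : (C (X ^ m) * (((1 - X) ^ m * bernPoly p q ^ (N - m)).map C)
        * (N.choose m : ℝ[X][X]))
        = C (C (N.choose m : ℝ) * X ^ m) * (((1 - X) ^ m * bernPoly p q ^ (N - m)).map C) := by
      simp only [map_mul, map_natCast]; ring
    rw [e, coeff_C_mul, coeff_map, mul_right_comm, ← C_mul, coeff_C_mul, coeff_X_pow]
    by_cases h : m = k
    · subst h; simp
    · simp [h, Ne.symm h]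
  rw [Finset.sum_congr rfl e, Finset.sum_ite_eq'] at h2
  have h3 : (C (N.choose j : ℝ) * ((C q - X) ^ j * (C p + X) ^ (N - j))).coeff k
      = ((N.choose j : ℝ[X]) * ((C q - X) ^ j * (C p + X) ^ (N - j))).coeff k := by simp
  rw [h3, h2]
  split_ifs with hk
  · rfl
  · rw [Nat.choose_eq_zero_of_lt (by simpa using hk)]; simp

/-- Diagonal case of Krawtchouk orthogonality. With Q_j(Y) the generating function in k, the sum of
Q_j(Y)Q_j(Z) over j, divided by the binomial weights, is the N-th power of (q−Y)(q−Z)/q +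
(p+Y)(p+Z)/p = 1 + YZ/(pq); the coefficient of Y^k Z^k is read off. -/
lemma sum_sq_krawtchouk {p q : ℝ} (hp : 0 < p) (hq : 0 < q) (hpq : p + q = 1) {N k : ℕ}
    (hk : k ≤ N) :
    ∑ j ∈ Finset.range (N + 1), ((1 - X) ^ k * bernPoly p q ^ (N - k)).coeff j ^ 2
        / (N.choose j * (q ^ j * p ^ (N - j)))
      = 1 / (N.choose k * (p * q) ^ k) := by
  set Q : ℕ → ℝ[X] := fun j => C (N.choose j : ℝ) * ((C q - X) ^ j * (C p + X) ^ (N - j)) with hQ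
  have hgen : ∑ j ∈ Finset.range (N + 1), C (C (1 / (N.choose j * (q ^ j * p ^ (N - j)))) * Q j)
        * (Q j).map C = (C 1 + C (C (1 / (p * q)) * X) * X : ℝ[X][X]) ^ N := by
    have e : (C 1 + C (C (1 / (p * q)) * X) * X : ℝ[X][X])
        = C (C (1 / q) * (C q - X)) * (C q - X : ℝ[X]).map C
          + C (C (1 / p) * (C p + X)) * (C p + X : ℝ[X]).map C := by
      have e1 : (C (C (1 / q)) * C (C q) : ℝ[X][X]) = 1 := by
        rw [← C_mul, ← C_mul, one_div_mul_cancel hq.ne']; simp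
      have e2 : (C (C (1 / p)) * C (C p) : ℝ[X][X]) = 1 := by
        rw [← C_mul, ← C_mul, one_div_mul_cancel hp.ne']; simp
      have e3 : (C (C (1 / (p * q))) : ℝ[X][X]) = C (C (1 / q)) + C (C (1 / p)) := by
        rw [← C_add, ← C_add]; congr 2; field_simp; linarith
      have e4 : (C (C q) + C (C p) : ℝ[X][X]) = 1 := by
        rw [← C_add, ← C_add, add_comm, hpq]; simp
      simp only [Polynomial.map_sub, Polynomial.map_add, map_X, map_C, C_mul, C_sub, C_add, e3,
        C_1]
      linear_combination (-(C (C q)) + X + C X) * e1 + (-(C (C p)) - X - C X) * e2 - e4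
    rw [e, add_pow]
    refine Finset.sum_congr rfl fun j hj => ?_
    have hc : (N.choose j : ℝ) ≠ 0 := by
      exact_mod_cast (Nat.choose_pos (Nat.lt_succ_iff.1 (Finset.mem_range.1 hj))).ne'
    have hw : (C (C (1 / (N.choose j * (q ^ j * p ^ (N - j)))) * C (N.choose j : ℝ)
          * C (N.choose j : ℝ)) : ℝ[X][X])
        = C (C (1 / q)) ^ j * C (C (1 / p)) ^ (N - j) * (N.choose j : ℝ[X][X]) := by
      have : (1 / (N.choose j * (q ^ j * p ^ (N - j))) * N.choose j * N.choose j : ℝ)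
          = (1 / q) ^ j * (1 / p) ^ (N - j) * N.choose j := by
        rw [one_div_pow, one_div_pow]; field_simp
      rw [← C_mul, ← C_mul, this]
      simp only [map_mul, map_pow, map_natCast]
    simp only [hQ, Polynomial.map_mul, Polynomial.map_pow, C_mul, C_pow, map_C] at hw ⊢
    simp only [mul_pow]
    linear_combination (C (C q - X) ^ j * C (C p + X) ^ (N - j) * map C (C q - X) ^ j
      * map C (C p + X) ^ (N - j)) * hw
  have h2 := congrArg (fun P : ℝ[X][X] => (P.coeff k).coeff k) hgen
  simp only [coeff_linear_pow, finsetSum_coeff, coeff_C_mul, coeff_map, coeff_mul_C, one_pow,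
    mul_one, mul_pow] at h2
  have hck : (N.choose k : ℝ) ≠ 0 := by exact_mod_cast (Nat.choose_pos hk).ne'
  have h3 : ∀ j, (Q j).coeff k = N.choose k * ((1 - X) ^ k * bernPoly p q ^ (N - k)).coeff j :=
    fun j => (choose_mul_coeff_krawtchouk N j k).symm
  have h4 : ((N.choose k : ℝ[X]) * (C (1 / (p * q)) ^ k * X ^ k)).coeff k
      = N.choose k * (1 / (p * q)) ^ k := by
    rw [← C_eq_natCast, ← C_pow, coeff_C_mul, coeff_C_mul, coeff_X_pow, if_pos rfl, mul_one]
  rw [h4] at h2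
  simp only [h3] at h2
  have h5 : (N.choose k : ℝ) ^ 2 * ∑ j ∈ Finset.range (N + 1),
      ((1 - X) ^ k * bernPoly p q ^ (N - k)).coeff j ^ 2 / (N.choose j * (q ^ j * p ^ (N - j)))
      = N.choose k * (1 / (p * q)) ^ k := by
    rw [← h2, Finset.mul_sum]
    refine Finset.sum_congr rfl fun j _ => by ring
  have h6 : (N.choose k : ℝ) * (∑ j ∈ Finset.range (N + 1),
      ((1 - X) ^ k * bernPoly p q ^ (N - k)).coeff j ^ 2 / (N.choose j * (q ^ j * p ^ (N - j))))
      = (1 / (p * q)) ^ k := by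
    apply mul_left_cancel₀ hck
    linear_combination h5
  rw [eq_div_iff (by positivity), ← mul_assoc, mul_comm _ (N.choose k : ℝ), h6, ← mul_pow,
    one_div_mul_cancel (by positivity), one_pow]

lemma natDegree_bernPoly_pow_le (p q : ℝ) (n : ℕ) : (bernPoly p q ^ n).natDegree ≤ n := by
  have h : (bernPoly p q).natDegree ≤ 1 := by
    rw [bernPoly, add_comm]
    exact natDegree_linear_le
  simpa using natDegree_pow_le_of_le n h

/-- Cauchy–Schwarz with the binomial law as weight: one factor is the Krawtchouk square sum, the
other the binomial generating function at r². -/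
lemma wnorm_krawtchouk_le {p q r : ℝ} (hp : 0 < p) (hq : 0 < q) (hpq : p + q = 1) (hr : 0 < r)
    (n k : ℕ) :
    wnorm r ((1 - X) ^ k * bernPoly p q ^ n)
      ≤ √(p + q * r ^ 2) ^ (n + k) / √((n + k).choose k * (p * q) ^ k) := by
  set f := (1 - X) ^ k * bernPoly p q ^ n with hf
  have hdeg : f.natDegree < n + k + 1 := by
    refine Nat.lt_succ_of_le (natDegree_mul_le.trans ?_)
    have h1 : ((1 - X : ℝ[X]) ^ k).natDegree ≤ k := by
      have h : (1 - X : ℝ[X]).natDegree ≤ 1 := by compute_degree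
      simpa using natDegree_pow_le_of_le k h
    have := natDegree_bernPoly_pow_le p q n
    omega
  set P : ℕ → ℝ := fun j => (n + k).choose j * (q ^ j * p ^ (n + k - j)) with hP
  have hPpos : ∀ j ∈ Finset.range (n + k + 1), 0 < P j := fun j hj => by
    have : 0 < (n + k).choose j := Nat.choose_pos (Nat.lt_succ_iff.1 (Finset.mem_range.1 hj))
    simp only [hP]; positivity
  have hcs : (∑ j ∈ Finset.range (n + k + 1), |f.coeff j| * r ^ j) ^ 2
      ≤ (∑ j ∈ Finset.range (n + k + 1), f.coeff j ^ 2 / P j)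
        * ∑ j ∈ Finset.range (n + k + 1), P j * (r ^ 2) ^ j := by
    refine Finset.sum_sq_le_sum_mul_sum_of_sq_le_mul _
      (fun j hj => div_nonneg (sq_nonneg _) (hPpos j hj).le)
      (fun j hj => mul_nonneg (hPpos j hj).le (by positivity)) fun j hj => le_of_eq ?_
    have := (hPpos j hj).ne'
    rw [mul_pow, sq_abs]; field_simp; ring
  have h1 : ∑ j ∈ Finset.range (n + k + 1), f.coeff j ^ 2 / P j
      = 1 / ((n + k).choose k * (p * q) ^ k) := by
    have := sum_sq_krawtchouk hp hq hpq (N := n + k) (k := k) (by omega)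
    simpa [hf] using this
  have h2 : ∑ j ∈ Finset.range (n + k + 1), P j * (r ^ 2) ^ j = (p + q * r ^ 2) ^ (n + k) := by
    rw [add_comm p, add_pow]
    refine Finset.sum_congr rfl fun j _ => ?_
    simp only [hP]; ring
  rw [wnorm_eq_sum hdeg]
  have hc : (0:ℝ) < (n + k).choose k * (p * q) ^ k := by
    have : 0 < (n + k).choose k := Nat.choose_pos (by omega)
    positivity
  refine abs_le_of_sq_le_sq' ?_ (by positivity) |>.2
  rw [div_pow, Real.sq_sqrt hc.le, ← pow_mul, mul_comm (n + k), pow_mul,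
    Real.sq_sqrt (by positivity)]
  rw [h1, h2] at hcs
  rwa [one_div_mul_eq_div] at hcs

/-- `q (1 - X) ^ 2` with `q` the variance of a Bernoulli variable. -/
noncomputable def diffPoly (p q : ℝ) : ℝ[X] := C (p * q) * (1 - X) ^ 2

/-- Trades the square root of C(a+2m, 2m) coming from Cauchy–Schwarz for C(a+m, m), whose reciprocal
is a Beta integral. -/
lemma choose_sq_le (a m : ℕ) :
    ((a + m).choose m) ^ 2 ≤ 4 ^ m * (a + 2 * m).choose (2 * m) := by
  have h1 : (2 * m).choose m * (a + 2 * m).choose (2 * m)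
      = (a + 2 * m).choose m * (a + m).choose m := by
    have := Nat.choose_mul (n := a + 2 * m) (k := 2 * m) (s := m) (by omega)
    have e1 : a + 2 * m - m = a + m := by omega
    have e2 : 2 * m - m = m := by omega
    rw [e1, e2] at this
    linarith
  have h2 : (a + m).choose m ≤ (a + 2 * m).choose m := Nat.choose_le_choose m (by omega)
  have h3 : (2 * m).choose m ≤ 4 ^ m := by
    rw [← Nat.centralBinom_eq_two_mul_choose]
    exact Nat.centralBinom_le_four_pow m
  calc ((a + m).choose m) ^ 2 ≤ (a + 2 * m).choose m * (a + m).choose m := by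
        rw [sq]; exact Nat.mul_le_mul_right _ h2
    _ = (2 * m).choose m * (a + 2 * m).choose (2 * m) := h1.symm
    _ ≤ _ := Nat.mul_le_mul_right _ h3

lemma wnorm_diffPoly_pow_mul_le {p q r : ℝ} (hp : 0 < p) (hq : 0 < q) (hpq : p + q = 1)
    (hr : 0 < r) (a m : ℕ) :
    wnorm r (diffPoly p q ^ m * bernPoly p q ^ a)
      ≤ √(p + q * r ^ 2) ^ (a + 2 * m) * (2 ^ m / (a + m).choose m) := by
  have e : diffPoly p q ^ m * bernPoly p q ^ a
      = C ((p * q) ^ m) * ((1 - X) ^ (2 * m) * bernPoly p q ^ a) := by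
    rw [diffPoly, mul_pow, ← pow_mul, C_pow, mul_assoc]
  have hpq0 : 0 < p * q := mul_pos hp hq
  have hc : (0:ℝ) < (a + 2 * m).choose (2 * m) := by
    exact_mod_cast Nat.choose_pos (by omega)
  have hd : (0:ℝ) < (a + m).choose m := by exact_mod_cast Nat.choose_pos (by omega)
  have h := wnorm_krawtchouk_le hp hq hpq hr a (2 * m)
  rw [e, wnorm_C_mul, abs_of_pos (pow_pos hpq0 m)]
  have h1 : √((a + 2 * m).choose (2 * m) * (p * q) ^ (2 * m))
      = √((a + 2 * m).choose (2 * m)) * (p * q) ^ m := by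
    rw [Real.sqrt_mul hc.le, mul_comm 2 m, pow_mul, Real.sqrt_sq (by positivity)]
  rw [h1] at h
  have h2 : ((a + m).choose m : ℝ) ≤ 2 ^ m * √((a + 2 * m).choose (2 * m)) := by
    refine abs_le_of_sq_le_sq' ?_ (by positivity) |>.2
    rw [mul_pow, Real.sq_sqrt hc.le, ← pow_mul, mul_comm m 2, pow_mul]
    norm_num
    exact_mod_cast choose_sq_le a m
  calc (p * q) ^ m * wnorm r ((1 - X) ^ (2 * m) * bernPoly p q ^ a)
      ≤ (p * q) ^ m * (√(p + q * r ^ 2) ^ (a + 2 * m)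
          / (√((a + 2 * m).choose (2 * m)) * (p * q) ^ m)) := by gcongr
    _ = √(p + q * r ^ 2) ^ (a + 2 * m) * (1 / √((a + 2 * m).choose (2 * m))) := by
        field_simp
    _ ≤ _ := by
        refine mul_le_mul_of_nonneg_left ?_ (by positivity)
        rw [div_le_div_iff₀ (by positivity) hd]
        linarith

end WeightedNorm

/-! ### Beta integrals -/

section BetaIntegral

lemma beta_recurrence (a m : ℕ) :
    (a + 1 : ℝ) * ∫ x in (0:ℝ)..1, x ^ a * (1 - x) ^ (m + 1)
      = (m + 1) * ∫ x in (0:ℝ)..1, x ^ (a + 1) * (1 - x) ^ m := by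
  have hd : ∀ x ∈ Set.uIcc (0:ℝ) 1, HasDerivAt (fun x : ℝ => x ^ (a + 1) * (1 - x) ^ (m + 1))
      ((a + 1) * (x ^ a * (1 - x) ^ (m + 1)) - (m + 1) * (x ^ (a + 1) * (1 - x) ^ m)) x := by
    intro x _
    convert! (hasDerivAt_pow (a + 1) x).mul (((hasDerivAt_id x).const_sub 1).pow (m + 1)) using 1
    push_cast
    simp
    ring
  have h := intervalIntegral.integral_eq_sub_of_hasDerivAt hd (Continuous.intervalIntegrable (by fun_prop) _ _)
  rw [intervalIntegral.integral_sub (Continuous.intervalIntegrable (by fun_prop) _ _)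
    (Continuous.intervalIntegrable (by fun_prop) _ _), intervalIntegral.integral_const_mul,
    intervalIntegral.integral_const_mul] at h
  simp at h
  linarith

/-- Makes 1 / C(a+m, m) a linear functional of x^a (1−x)^m, so that sums of products of Bernoulli
and difference factors can be bounded under one integral. -/
lemma choose_mul_beta (a m : ℕ) :
    (a + m + 1 : ℝ) * (a + m).choose m * ∫ x in (0:ℝ)..1, x ^ a * (1 - x) ^ m = 1 := by
  induction m generalizing a with
  | zero =>
    have : (a + 1 : ℝ) ≠ 0 := by positivity
    simp [this]
  | succ m ih =>
    have h1 := beta_recurrence a m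
    have h2 := ih (a + 1)
    have h3 : ((a + (m + 1)).choose (m + 1) * (m + 1) : ℝ) = (a + 1 + m).choose m * (a + 1) := by
      have := Nat.choose_succ_right_eq (a + 1 + m) m
      rw [show a + 1 + m - m = a + 1 by omega] at this
      rw [show a + (m + 1) = a + 1 + m by omega]
      exact_mod_cast this
    have ha : (a + 1 : ℝ) ≠ 0 := by positivity
    have hm : (m + 1 : ℝ) ≠ 0 := by positivity
    push_cast at h2 ⊢
    apply mul_left_cancel₀ (mul_ne_zero ha hm)
    set J := ∫ x in (0:ℝ)..1, x ^ a * (1 - x) ^ (m + 1)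
    set J' := ∫ x in (0:ℝ)..1, x ^ (a + 1) * (1 - x) ^ m
    linear_combination (a + (m + 1) + 1 : ℝ) * (a + (m + 1)).choose (m + 1) * (m + 1) * h1
      + (a + (m + 1) + 1 : ℝ) * (m + 1) * J' * h3 + (a + 1 : ℝ) * (m + 1) * h2

lemma integral_midpoint_pow_mul_le (n : ℕ) :
    ∫ x in (0:ℝ)..1, ((1 + x) / 2) ^ n * (2 * (1 - x)) ≤ 8 / ((n + 1) * (n + 2)) := by
  have hd : ∀ x ∈ Set.uIcc (0:ℝ) 1,
      HasDerivAt (fun x : ℝ => 8 * (((1 + x) / 2) ^ (n + 1) / (n + 1)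
        - ((1 + x) / 2) ^ (n + 2) / (n + 2))) (((1 + x) / 2) ^ n * (2 * (1 - x))) x := by
    intro x _
    have h0 : HasDerivAt (fun x : ℝ => (1 + x) / 2) (1 / 2) x :=
      ((hasDerivAt_id x).const_add 1).div_const 2
    have h1 := (h0.pow (n + 1)).div_const (n + 1 : ℝ)
    have h2 := (h0.pow (n + 2)).div_const (n + 2 : ℝ)
    convert! (h1.sub h2).const_mul 8 using 1
    push_cast
    have e1 : (n + 1 : ℝ) ≠ 0 := by positivity
    have e2 : (n + 2 : ℝ) ≠ 0 := by positivity
    field_simp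
    ring
  rw [intervalIntegral.integral_eq_sub_of_hasDerivAt hd (Continuous.intervalIntegrable (by fun_prop) _ _)]
  have h1 : (1 : ℝ) / (n + 2) ≤ 1 / (n + 1) := by gcongr; norm_num
  -- The antiderivative is nonnegative at 0, so its value at 1 alone is an upper bound.
  have h2 : (0:ℝ) ≤ ((1 + 0) / 2) ^ (n + 1) / (n + 1) - ((1 + 0) / 2) ^ (n + 2) / (n + 2) := by
    have h3 : ((1 + 0) / 2 : ℝ) ^ (n + 2) ≤ ((1 + 0) / 2 : ℝ) ^ (n + 1) :=
      pow_le_pow_of_le_one (by norm_num) (by norm_num) (by omega)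
    have : ((1 + 0) / 2 : ℝ) ^ (n + 2) / (n + 2) ≤ ((1 + 0) / 2 : ℝ) ^ (n + 1) / (n + 1) := by
      gcongr
      norm_num
    linarith
  have h3 : (8 : ℝ) / ((n + 1) * (n + 2)) = 8 * (1 / (n + 1) - 1 / (n + 2)) := by
    field_simp; ring
  norm_num at h2 h3 ⊢
  linarith

end BetaIntegral

/-! ### Replacing polynomials by functions on [0, 1] -/

section Domination

open Polynomial

/-- `f` is dominated in degree `n` by the function `A` on `[0, 1]`: the weighted norm of `f` times
any product of Bernoulli and second difference factors is controlled by the integral of `A` against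
the corresponding product of the factors `x` and `2 (1 - x)`. -/
def Dominated (p q r : ℝ) (n : ℕ) (f : ℝ[X]) (A : ℝ → ℝ) : Prop :=
  ∀ a m : ℕ, wnorm r (f * (diffPoly p q ^ m * bernPoly p q ^ a))
    ≤ √(p + q * r ^ 2) ^ (n + a + 2 * m)
      * ((n + a + 2 * m + 1) * ∫ x in (0:ℝ)..1, A x * (x ^ a * (2 * (1 - x)) ^ m))

namespace Dominated

variable {p q r : ℝ} {n : ℕ} {f g : ℝ[X]} {A B : ℝ → ℝ}

lemma one (hp : 0 < p) (hq : 0 < q) (hpq : p + q = 1) (hr : 0 < r) :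
    Dominated p q r 0 1 1 := by
  intro a m
  have h := wnorm_diffPoly_pow_mul_le hp hq hpq hr a m
  have hb := choose_mul_beta a m
  have hc : (0:ℝ) < (a + m).choose m := by exact_mod_cast Nat.choose_pos (by omega)
  set J := ∫ x in (0:ℝ)..1, x ^ a * (1 - x) ^ m with hJ
  have e : ∫ x in (0:ℝ)..1, (1 : ℝ → ℝ) x * (x ^ a * (2 * (1 - x)) ^ m) = 2 ^ m * J := by
    rw [hJ, ← intervalIntegral.integral_const_mul]
    refine intervalIntegral.integral_congr fun x _ => ?_
    simp only [Pi.one_apply, mul_pow]; ring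
  rw [one_mul, e]
  refine h.trans ?_
  rw [zero_add]
  refine mul_le_mul_of_nonneg_left ?_ (by positivity)
  have hJ0 : 0 ≤ J := by
    have : 0 < (a + m + 1 : ℝ) * (a + m).choose m := by positivity
    by_contra hneg
    nlinarith [mul_neg_of_pos_of_neg this (not_le.1 hneg)]
  rw [div_eq_mul_inv]
  have : ((a + m).choose m : ℝ)⁻¹ = (a + m + 1) * J := by
    rw [inv_eq_iff_eq_inv, eq_comm]
    rw [inv_eq_iff_eq_inv, ← mul_eq_one_iff_eq_inv₀ hc.ne']
    linarith
  rw [this]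
  push_cast
  -- The Beta identity gives the factor a + m + 1; the larger a + 2m + 1 counts the degree, with Δ
  -- of degree 2, and so is compatible with multiplication.
  have h2 : (0:ℝ) ≤ 2 ^ m * J := by positivity
  have h3 : (0:ℝ) ≤ m := by positivity
  nlinarith [mul_nonneg h2 h3]

lemma integral_nonneg (hp : 0 < p) (hq : 0 ≤ q) (hr : 0 ≤ r) (h : Dominated p q r n f A)
    (a m : ℕ) : 0 ≤ ∫ x in (0:ℝ)..1, A x * (x ^ a * (2 * (1 - x)) ^ m) := by
  have h1 := (wnorm_nonneg hr _).trans (h a m)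
  have h2 : 0 < √(p + q * r ^ 2) ^ (n + a + 2 * m) :=
    pow_pos (Real.sqrt_pos.2 (by positivity)) _
  have h3 := nonneg_of_mul_nonneg_right h1 h2
  exact nonneg_of_mul_nonneg_right h3 (by positivity)

lemma mono (h : Dominated p q r n f A) (hA : Continuous A) (hB : Continuous B)
    (hAB : ∀ x ∈ Set.Icc (0:ℝ) 1, A x ≤ B x) : Dominated p q r n f B := by
  intro a m
  refine (h a m).trans ?_
  refine mul_le_mul_of_nonneg_left (mul_le_mul_of_nonneg_left ?_ (by positivity)) (by positivity)
  refine intervalIntegral.integral_mono_on zero_le_one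
    (Continuous.intervalIntegrable (by fun_prop) _ _)
    (Continuous.intervalIntegrable (by fun_prop) _ _) fun x hx => ?_
  refine mul_le_mul_of_nonneg_right (hAB x hx) ?_
  have := hx.1
  have := sub_nonneg.2 hx.2
  positivity

lemma add (hr : 0 ≤ r) (h : Dominated p q r n f A) (h' : Dominated p q r n g B)
    (hA : Continuous A) (hB : Continuous B) :
    Dominated p q r n (f + g) (fun x => A x + B x) := by
  intro a m
  rw [add_mul]
  refine (wnorm_add_le hr _ _).trans ((add_le_add (h a m) (h' a m)).trans_eq ?_)
  simp only [add_mul]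
  rw [intervalIntegral.integral_add (Continuous.intervalIntegrable (by fun_prop) _ _)
    (Continuous.intervalIntegrable (by fun_prop) _ _)]
  ring

lemma C_mul (h : Dominated p q r n f A) (c : ℝ) :
    Dominated p q r n (C c * f) (fun x => |c| * A x) := by
  intro a m
  rw [mul_assoc, wnorm_C_mul]
  refine (mul_le_mul_of_nonneg_left (h a m) (abs_nonneg c)).trans_eq ?_
  simp only [mul_assoc |c|]
  rw [intervalIntegral.integral_const_mul]
  ring

/-- Only a shift of `a`: quantifying over all test factors in the definition is what makes
domination stable under multiplication by B, and likewise by Δ. -/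
lemma bernPoly_mul (h : Dominated p q r n f A) :
    Dominated p q r (n + 1) (bernPoly p q * f) (fun x => x * A x) := by
  intro a m
  have h1 := h (a + 1) m
  have e : bernPoly p q * f * (diffPoly p q ^ m * bernPoly p q ^ a)
      = f * (diffPoly p q ^ m * bernPoly p q ^ (a + 1)) := by ring
  rw [e]
  refine h1.trans_eq ?_
  rw [show n + 1 + a + 2 * m = n + (a + 1) + 2 * m by ring]
  congr 2
  · push_cast; ring
  · refine intervalIntegral.integral_congr fun x _ => ?_
    ring

lemma diffPoly_mul (h : Dominated p q r n f A) :
    Dominated p q r (n + 2) (diffPoly p q * f) (fun x => 2 * (1 - x) * A x) := by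
  intro a m
  have h1 := h a (m + 1)
  have e : diffPoly p q * f * (diffPoly p q ^ m * bernPoly p q ^ a)
      = f * (diffPoly p q ^ (m + 1) * bernPoly p q ^ a) := by ring
  rw [e]
  refine h1.trans_eq ?_
  rw [show n + 2 + a + 2 * m = n + a + 2 * (m + 1) by ring]
  congr 2
  · push_cast; ring
  · refine intervalIntegral.integral_congr fun x _ => ?_
    ring

/-- The factor q + pX is not among the test factors, so it is bounded crudely by its norm q + pr.
This is affordable because it always comes with a factor λ. -/
lemma bernPoly_swap_mul {ρ : ℝ} (hp : 0 < p) (hq : 0 < q) (hr : 0 ≤ r) (hρ : 0 ≤ ρ)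
    (hν : q + p * r ≤ ρ * √(p + q * r ^ 2)) (h : Dominated p q r n f A) :
    Dominated p q r (n + 1) (bernPoly q p * f) (fun x => ρ * A x) := by
  intro a m
  have h1 := h a m
  have h0 := h.integral_nonneg hp hq.le hr a m
  set κ := √(p + q * r ^ 2)
  have hκ : 0 ≤ κ := Real.sqrt_nonneg _
  rw [mul_assoc]
  simp only [mul_assoc ρ]
  rw [intervalIntegral.integral_const_mul]
  set J := ∫ x in (0:ℝ)..1, A x * (x ^ a * (2 * (1 - x)) ^ m)
  calc _ ≤ (q + p * r) * wnorm r (f * (diffPoly p q ^ m * bernPoly p q ^ a)) :=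
        wnorm_bernPoly_mul_le hr hq.le hp.le _
    _ ≤ (ρ * κ) * (κ ^ (n + a + 2 * m) * ((n + a + 2 * m + 1) * J)) :=
        mul_le_mul hν h1 (wnorm_nonneg hr _) (by positivity)
    _ = κ ^ (n + 1 + a + 2 * m) * ((n + a + 2 * m + 1) * (ρ * J)) := by ring
    _ ≤ _ := by
        refine mul_le_mul_of_nonneg_left (mul_le_mul_of_nonneg_right ?_ (by positivity))
          (by positivity)
        push_cast; linarith

end Dominated

end Domination

/-! ### Generating functions of the walk and their domination -/

section WalkPolynomials

open Polynomial

/-- The generating function of the label sum of a sticky walk of length `n`, together with the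
quotient by `1 - X` of the difference of the generating functions conditioned on the initial
label. -/
noncomputable def walkPair (p q lam : ℝ) : ℕ → ℝ[X] × ℝ[X]
  | 0 => (1, 0)
  | n + 1 => (bernPoly p q * (walkPair p q lam n).1 + C lam * (diffPoly p q * (walkPair p q lam n).2),
      (walkPair p q lam n).1 + C lam * (bernPoly q p * (walkPair p q lam n).2))

/-- The generating function of the label sum of a sticky walk. -/
noncomputable def walkPoly (p q lam : ℝ) (n : ℕ) : ℝ[X] := (walkPair p q lam n).1

/-- The difference of the generating functions of the label sum conditioned on the initial label,
divided by `1 - X`. -/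
noncomputable def gapPoly (p q lam : ℝ) (n : ℕ) : ℝ[X] := (walkPair p q lam n).2

variable {p q lam : ℝ}

@[simp] lemma walkPoly_zero : walkPoly p q lam 0 = 1 := rfl

@[simp] lemma gapPoly_zero : gapPoly p q lam 0 = 0 := rfl

lemma walkPoly_succ (n : ℕ) : walkPoly p q lam (n + 1)
    = bernPoly p q * walkPoly p q lam n + C lam * (diffPoly p q * gapPoly p q lam n) := rfl

lemma gapPoly_succ (n : ℕ) : gapPoly p q lam (n + 1)
    = walkPoly p q lam n + C lam * (bernPoly q p * gapPoly p q lam n) := rfl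

lemma walkPoly_one : walkPoly p q lam 1 = bernPoly p q := by
  simp [walkPoly_succ]

/-- A transition is a fresh draw from p plus λ times (stay minus fresh draw); the second part
couples the two sides of the cut through the differences (1 − X)D_s and (1 − X)D_u. The two-step
induction needs no addition formula for D, since the recurrence for F expresses λΔD_{s+u} through F.
-/
lemma walkPoly_add (s u : ℕ) : walkPoly p q lam (s + u)
    = walkPoly p q lam s * walkPoly p q lam u
      + C lam * (diffPoly p q * (gapPoly p q lam s * gapPoly p q lam u)) := by
  induction s using Nat.twoStepInduction with
  | zero => simp
  | one => rw [add_comm 1 u, walkPoly_succ]; simp [walkPoly_one, gapPoly_succ]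
  | more s ih0 ih1 =>
    have e2 : walkPoly p q lam (s + 2 + u) = bernPoly p q * walkPoly p q lam (s + 1 + u)
        + C lam * (diffPoly p q * (walkPoly p q lam (s + u)
          + C lam * (bernPoly q p * gapPoly p q lam (s + u)))) := by
      rw [show s + 2 + u = (s + 1 + u) + 1 by ring, walkPoly_succ,
        show s + 1 + u = (s + u) + 1 by ring, gapPoly_succ]
    have e1 : walkPoly p q lam (s + 1 + u) = bernPoly p q * walkPoly p q lam (s + u)
        + C lam * (diffPoly p q * gapPoly p q lam (s + u)) := by
      rw [show s + 1 + u = (s + u) + 1 by ring, walkPoly_succ]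
    have f1 := walkPoly_succ (p := p) (q := q) (lam := lam) s
    have g1 := gapPoly_succ (p := p) (q := q) (lam := lam) s
    have f2 := walkPoly_succ (p := p) (q := q) (lam := lam) (s + 1)
    have g2 := gapPoly_succ (p := p) (q := q) (lam := lam) (s + 1)
    rw [show s + 2 = s + 1 + 1 by ring] at e2 ⊢
    rw [g1] at g2 f2
    rw [f1] at f2 g2
    rw [f1, g1] at ih1
    rw [f2, g2, e2]
    rw [ih1]
    rw [ih1, ih0] at e1
    rw [ih0]
    linear_combination (-(C lam * bernPoly q p)) * e1

/-- The rate (1+x)/2 lies above x, which leaves room to absorb the λ terms. The bounds for F_t,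
F_{t+1} and D_{t+1} are carried together because the recurrences mix them. -/
theorem Dominated.walkPoly_mul {r ρ : ℝ} {n : ℕ} {h : ℝ[X]} {A : ℝ → ℝ} (hp : 0 < p) (hq : 0 < q)
    (hr : 0 ≤ r) (hρ : 0 ≤ ρ) (hν : q + p * r ≤ ρ * √(p + q * r ^ 2)) (hl : |lam| ≤ 1 / 100)
    (hlρ : |lam| * ρ ≤ 1 / 10) (hA : Continuous A) (hA0 : ∀ x ∈ Set.Icc (0:ℝ) 1, 0 ≤ A x)
    (H : Dominated p q r n h A) (t : ℕ) :
    Dominated p q r (n + t) (walkPoly p q lam t * h) (fun x => ((1 + x) / 2) ^ t * A x) ∧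
    Dominated p q r (n + (t + 1)) (walkPoly p q lam (t + 1) * h)
      (fun x => ((1 + x) / 2) ^ (t + 1) * A x) ∧
    Dominated p q r (n + t) (gapPoly p q lam (t + 1) * h)
      (fun x => 2 * ((1 + x) / 2) ^ t * A x) := by
  induction t with
  | zero =>
    refine ⟨by simpa using H, ?_, ?_⟩
    · have h1 : Dominated p q r (n + 1) (walkPoly p q lam 1 * h) (fun x => x * A x) := by
        rw [walkPoly_one]
        exact H.bernPoly_mul
      refine h1.mono (by fun_prop) (by fun_prop) fun x hx => ?_
      refine mul_le_mul_of_nonneg_right ?_ (hA0 x hx)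
      simp; linarith [hx.2]
    · have h1 : Dominated p q r (n + 0) (gapPoly p q lam 1 * h) A := by
        simpa [gapPoly_succ] using H
      refine h1.mono hA (by fun_prop) fun x hx => ?_
      have := hA0 x hx
      simp; linarith
  | succ t ih =>
    obtain ⟨-, h2, h3⟩ := ih
    refine ⟨h2, ?_, ?_⟩
    · have h4 := h2.bernPoly_mul.add hr (h3.diffPoly_mul.C_mul lam) (by fun_prop) (by fun_prop)
      have e : walkPoly p q lam (t + 1 + 1) * h = bernPoly p q * (walkPoly p q lam (t + 1) * h)
          + C lam * (diffPoly p q * (gapPoly p q lam (t + 1) * h)) := by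
        rw [walkPoly_succ (t + 1)]; ring
      rw [e]
      refine Dominated.mono h4 (by fun_prop) (by fun_prop) fun x hx => ?_
      have hx0 := hx.1
      have hx1 := sub_nonneg.2 hx.2
      have hw : (0:ℝ) ≤ ((1 + x) / 2) ^ t * A x := mul_nonneg (by positivity) (hA0 x hx)
      -- The first two terms equal (1+x)(1−x)/4 ≥ (1−x)/4, and 4|λ| ≤ 1/25.
      have key : 0 ≤ (((1 + x) / 2) ^ 2 - x * ((1 + x) / 2) - 4 * |lam| * (1 - x)) := by
        nlinarith
      have := mul_nonneg hw key
      simp only [pow_succ] at this ⊢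
      linarith
    · have h4 := h2.add hr ((h3.bernPoly_swap_mul hp hq hr hρ hν).C_mul lam) (by fun_prop)
        (by fun_prop)
      have e : gapPoly p q lam (t + 1 + 1) * h = walkPoly p q lam (t + 1) * h
          + C lam * (bernPoly q p * (gapPoly p q lam (t + 1) * h)) := by
        rw [gapPoly_succ (t + 1)]; ring
      rw [e]
      refine Dominated.mono h4 (by fun_prop) (by fun_prop) fun x hx => ?_
      have hx0 := hx.1
      have hw : (0:ℝ) ≤ ((1 + x) / 2) ^ t * A x := mul_nonneg (by positivity) (hA0 x hx)
      have key : 0 ≤ (1 + x) / 2 - 2 * (|lam| * ρ) := by linarith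
      have := mul_nonneg hw key
      simp only [pow_succ] at this ⊢
      linarith

end WalkPolynomials

/-! ### Splitting and tail bounds -/

section WalkBounds

open Polynomial

variable {p q lam : ℝ}

lemma Dominated.wnorm_diffPoly_mul_le {r c : ℝ} {n k j : ℕ} {f : ℝ[X]} {A : ℝ → ℝ}
    (H : Dominated p q r n f A) (hA : Continuous A)
    (hAn : ∀ x ∈ Set.Icc (0:ℝ) 1, A x * x ^ j ≤ c * ((1 + x) / 2) ^ k) (hk : n + j = k)
    (hc : 0 ≤ c) :
    wnorm r (f * (diffPoly p q * bernPoly p q ^ j))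
      ≤ √(p + q * r ^ 2) ^ (k + 2) * (c * 24 / (k + 2)) := by
  have h := H j 1
  rw [pow_one] at h
  refine h.trans ?_
  have hκ : 0 ≤ √(p + q * r ^ 2) := Real.sqrt_nonneg _
  rw [show n + j + 2 * 1 = k + 2 by omega]
  refine mul_le_mul_of_nonneg_left ?_ (by positivity)
  have h1 : ∫ x in (0:ℝ)..1, A x * (x ^ j * (2 * (1 - x)) ^ 1)
      ≤ c * (8 / ((k + 1) * (k + 2))) := by
    refine le_trans ?_ (mul_le_mul_of_nonneg_left (integral_midpoint_pow_mul_le k) hc)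
    rw [← intervalIntegral.integral_const_mul]
    refine intervalIntegral.integral_mono_on zero_le_one
      (Continuous.intervalIntegrable (by fun_prop) _ _)
      (Continuous.intervalIntegrable (by fun_prop) _ _) fun x hx => ?_
    have := sub_nonneg.2 hx.2
    calc A x * (x ^ j * (2 * (1 - x)) ^ 1) = A x * x ^ j * (2 * (1 - x)) := by ring
      _ ≤ c * ((1 + x) / 2) ^ k * (2 * (1 - x)) :=
        mul_le_mul_of_nonneg_right (hAn x hx) (by positivity)
      _ = _ := by ring
  have hk' : (n + j : ℝ) = k := by exact_mod_cast hk
  calc (n + j + 2 * (1:ℕ) + 1 : ℝ) * ∫ x in (0:ℝ)..1, A x * (x ^ j * (2 * (1 - x)) ^ 1)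
      ≤ (n + j + 2 * (1:ℕ) + 1 : ℝ) * (c * (8 / ((k + 1) * (k + 2)))) :=
        mul_le_mul_of_nonneg_left h1 (by positivity)
    _ = c * ((k + 3) * 8 / (k + 1)) / (k + 2) := by
        rw [hk']; push_cast; field_simp; ring
    -- Here 8(k+3)/(k+1) ≤ 24, with equality at k = 0.
    _ ≤ c * 24 / (k + 2) := by
        gcongr
        rw [div_le_iff₀ (by positivity)]
        have : (0:ℝ) ≤ k := by positivity
        linarith

/-- Cutting a sticky walk into independent pieces changes the law of the label sum little. -/
lemma wnorm_prod_walkPoly_sub_le (hp : 0 < p) (hq : 0 < q) (hpq : p + q = 1)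
    (hl : |lam| ≤ 1 / 100) {ℓ n : ℕ} {h : ℝ[X]} (s : Fin (ℓ + 1) → ℕ) (hs : ∀ i, 1 ≤ s i)
    (H : Dominated p q 1 n h fun x => ((1 + x) / 2) ^ n) :
    wnorm 1 (h * (∏ i, walkPoly p q lam (s i) - walkPoly p q lam (∑ i, s i)))
      ≤ ℓ * (|lam| * (96 / (n + ∑ i, (s i : ℝ)))) := by
  have hsq : √(p + q * 1 ^ 2) = 1 := by rw [one_pow, mul_one, hpq, Real.sqrt_one]
  have hν : q + p * 1 ≤ 1 * √(p + q * 1 ^ 2) := by rw [hsq]; linarith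
  have step := fun {n : ℕ} {h : ℝ[X]} {A : ℝ → ℝ} (hA : Continuous A)
    (hA0 : ∀ x ∈ Set.Icc (0:ℝ) 1, 0 ≤ A x) (H : Dominated p q 1 n h A) (t : ℕ) =>
    H.walkPoly_mul (lam := lam) hp hq zero_le_one zero_le_one hν hl (by linarith) hA hA0 t
  induction ℓ generalizing n h with
  | zero => simp [wnorm_zero]
  | succ ℓ ih =>
    rw [Fin.prod_univ_succ, Fin.sum_univ_succ s, Fin.sum_univ_succ fun i => (s i : ℝ)]
    set u := ∑ i : Fin (ℓ + 1), s i.succ with hu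
    have hu1 : 1 ≤ u := (hs (Fin.succ 0)).trans
      (Finset.single_le_sum (f := fun i : Fin (ℓ + 1) => s i.succ) (fun _ _ => Nat.zero_le _)
        (Finset.mem_univ 0))
    obtain ⟨a, ha⟩ : ∃ a, s 0 = a + 1 := ⟨s 0 - 1, by have := hs 0; omega⟩
    obtain ⟨b, hb⟩ : ∃ b, u = b + 1 := ⟨u - 1, by omega⟩
    have hcast : ∑ i : Fin (ℓ + 1), (s i.succ : ℝ) = u := by rw [hu]; push_cast; rfl
    have H0 : ∀ n : ℕ, ∀ x ∈ Set.Icc (0:ℝ) 1, 0 ≤ ((1 + x) / 2) ^ n := fun n x hx => by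
      have := hx.1; positivity
    have H1 : Dominated p q 1 (n + s 0) (h * walkPoly p q lam (s 0))
        fun x => ((1 + x) / 2) ^ (n + s 0) := by
      have := (step (by fun_prop) (H0 n) H (s 0)).1
      rw [mul_comm h]
      convert this using 2
      ring
    have ih' := ih (fun i => s i.succ) (fun i => hs _) H1
    rw [← hu, hcast] at ih'
    have H2 := (step (by fun_prop) (H0 n) H a).2.2
    have H3 := (step (by fun_prop)
      (fun x hx => by have := hx.1; positivity) H2 b).2.2
    -- Each of the two gap polynomials contributes a factor 2, hence c = 4 and the constant 96 = 4 ·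
    -- 24.
    have H4 := H3.wnorm_diffPoly_mul_le (c := 4) (k := n + a + b) (j := 0) (by fun_prop)
      (fun x _ => le_of_eq (by ring)) rfl (by norm_num)
    rw [hsq, one_pow, one_mul] at H4
    rw [hcast]
    -- One cut after the first piece. That piece joins the prefix `h`, so the later cuts still see
    -- the full length and each costs 96|λ| over it.
    have e : h * (walkPoly p q lam (s 0) * ∏ i : Fin (ℓ + 1), walkPoly p q lam (s i.succ)
          - walkPoly p q lam (s 0 + u))
        = h * walkPoly p q lam (s 0) * (∏ i : Fin (ℓ + 1), walkPoly p q lam (s i.succ)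
            - walkPoly p q lam u)
          + C (-lam) * (gapPoly p q lam (b + 1) * (gapPoly p q lam (a + 1) * h)
            * (diffPoly p q * bernPoly p q ^ 0)) := by
      rw [walkPoly_add, ha, hb, map_neg]; ring
    rw [e]
    refine (wnorm_add_le zero_le_one _ _).trans ?_
    rw [wnorm_C_mul, abs_neg]
    have e2 : ((n + s 0 : ℕ) : ℝ) + u = n + (s 0 + u) := by push_cast; ring
    rw [e2] at ih'
    have e3 : ((n + a + b : ℕ) : ℝ) + 2 = n + (s 0 + u) := by rw [ha, hb]; push_cast; ring
    rw [e3] at H4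
    have := mul_le_mul_of_nonneg_left H4 (abs_nonneg lam)
    norm_num at this ih' ⊢
    linarith

/-- Duhamel expansion of the recurrence for F around the independent walk. -/
lemma walkPoly_succ_sub_pow (T : ℕ) : walkPoly p q lam (T + 1) - bernPoly p q ^ (T + 1)
    = C lam * ∑ j ∈ Finset.range T,
        gapPoly p q lam (T - j) * (diffPoly p q * bernPoly p q ^ j) := by
  induction T with
  | zero => simp [walkPoly_one]
  | succ T ih =>
    rw [walkPoly_succ, Finset.sum_range_succ']
    simp only [Nat.add_sub_add_right, Nat.sub_zero]
    have e : ∑ j ∈ Finset.range T,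
          gapPoly p q lam (T - j) * (diffPoly p q * bernPoly p q ^ (j + 1))
        = bernPoly p q * ∑ j ∈ Finset.range T,
          gapPoly p q lam (T - j) * (diffPoly p q * bernPoly p q ^ j) := by
      rw [Finset.mul_sum]
      exact Finset.sum_congr rfl fun j _ => by ring
    rw [e]
    linear_combination bernPoly p q * ih

lemma wnorm_walkPoly_sub_pow_le {r : ℝ} (hp : 0 < p) (hq : 0 < q) (hpq : p + q = 1)
    (hl : |lam| ≤ 1 / 100) (hr1 : 1 / 2 ≤ r) (hr2 : r ≤ 2) {t : ℕ} (ht : 1 ≤ t) :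
    wnorm r (walkPoly p q lam t - bernPoly p q ^ t) ≤ 48 * |lam| * √(p + q * r ^ 2) ^ t := by
  have hr : 0 < r := by linarith
  have hκ : (1 / 2 : ℝ) ≤ √(p + q * r ^ 2) := by
    refine Real.le_sqrt_of_sq_le ?_
    nlinarith [mul_nonneg hq.le (sub_nonneg.2 (show (1 / 2 : ℝ) ^ 2 ≤ r ^ 2 by gcongr))]
  -- The left side is at most 2 because r ≤ 2, and the root is at least 1/2, so ρ = 4 works.
  have hν : q + p * r ≤ 4 * √(p + q * r ^ 2) := by nlinarith
  obtain ⟨T, rfl⟩ : ∃ T, t = T + 1 := ⟨t - 1, by omega⟩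
  rw [walkPoly_succ_sub_pow, wnorm_C_mul]
  set κ := √(p + q * r ^ 2)
  have hterm : ∀ j ∈ Finset.range T,
      wnorm r (gapPoly p q lam (T - j) * (diffPoly p q * bernPoly p q ^ j))
        ≤ κ ^ (T + 1) * (48 / (T + 1)) := by
    intro j hj
    obtain ⟨k, hk⟩ : ∃ k, T = k + 1 + j := ⟨T - j - 1, by have := Finset.mem_range.1 hj; omega⟩
    have H := ((Dominated.one hp hq hpq hr).walkPoly_mul (lam := lam) (ρ := 4) hp hq hr.le
      (by norm_num) hν hl (by linarith) (continuous_const (y := (1:ℝ)))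
      (fun x _ => zero_le_one) k).2.2
    have H' := H.wnorm_diffPoly_mul_le (c := 2) (k := k + j) (j := j) (by fun_prop) ?_
      (by omega) (by norm_num)
    · rw [hk, show k + 1 + j - j = k + 1 by omega]
      rw [mul_one] at H'
      refine H'.trans_eq ?_
      rw [show k + 1 + j + 1 = k + j + 2 by ring]
      push_cast
      norm_num
      refine congrArg (fun y : ℝ => κ ^ (k + j + 2) * (48 / y)) ?_
      ring
    · intro x hx
      have h0 := hx.1
      have h1 : x ^ j ≤ ((1 + x) / 2) ^ j := pow_le_pow_left₀ h0 (by linarith [hx.2]) j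
      rw [pow_add]
      have : 0 ≤ ((1 + x) / 2) ^ k := by positivity
      nlinarith [mul_le_mul_of_nonneg_left h1 this]
  have h2 := (wnorm_sum_le hr.le _ _).trans (Finset.sum_le_sum hterm)
  rw [Finset.sum_const, Finset.card_range, nsmul_eq_mul] at h2
  have h3 : (T : ℝ) * (κ ^ (T + 1) * (48 / (T + 1))) ≤ 48 * κ ^ (T + 1) := by
    have : (T : ℝ) / (T + 1) ≤ 1 := by
      rw [div_le_one (by positivity)]; linarith
    calc (T : ℝ) * (κ ^ (T + 1) * (48 / (T + 1))) = 48 * κ ^ (T + 1) * (T / (T + 1)) := by ring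
      _ ≤ 48 * κ ^ (T + 1) * 1 := by gcongr
      _ = _ := mul_one _
  calc |lam| * _ ≤ |lam| * (48 * κ ^ (T + 1)) :=
        mul_le_mul_of_nonneg_left (h2.trans h3) (abs_nonneg _)
    _ = _ := by ring

lemma natDegree_walkPair_le (n : ℕ) : (walkPoly p q lam n).natDegree ≤ n ∧
    (gapPoly p q lam n).natDegree ≤ n - 1 := by
  have hb : ∀ p q : ℝ, (bernPoly p q).natDegree ≤ 1 := fun p q => by
    simpa using natDegree_bernPoly_pow_le p q 1
  have hd : (diffPoly p q).natDegree ≤ 2 := by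
    unfold diffPoly; compute_degree
  induction n with
  | zero => simp
  | succ n ih =>
    obtain ⟨h1, h2⟩ := ih
    rcases Nat.eq_zero_or_pos n with rfl | hn
    · refine ⟨by rw [walkPoly_one]; exact hb p q, by simp [gapPoly_succ]⟩
    · refine ⟨?_, ?_⟩
      · rw [walkPoly_succ]
        refine natDegree_add_le_of_degree_le ?_ ?_
        · exact (natDegree_mul_le.trans (add_le_add (hb p q) h1)).trans (by omega)
        · refine (natDegree_C_mul_le _ _).trans ?_
          exact (natDegree_mul_le.trans (add_le_add hd h2)).trans (by omega)
      · rw [gapPoly_succ]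
        refine natDegree_add_le_of_degree_le (by omega) ?_
        refine (natDegree_C_mul_le _ _).trans ?_
        exact (natDegree_mul_le.trans (add_le_add (hb q p) h2)).trans (by omega)

lemma natDegree_walkPoly_le (n : ℕ) : (walkPoly p q lam n).natDegree ≤ n :=
  (natDegree_walkPair_le n).1

/-- From e^y ≤ 1 + y + y² for |y| ≤ 1, then 1 + u ≤ e^u. -/
lemma two_point_mgf_le {p q y : ℝ} (hp : 0 ≤ p) (hq : 0 ≤ q) (hpq : p + q = 1) (hy : |y| ≤ 1) :
    p + q * Real.exp y ≤ Real.exp (q * y + y ^ 2) := by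
  have h1 := (abs_le.1 (Real.abs_exp_sub_one_sub_id_le hy)).2
  have h2 := Real.add_one_le_exp (q * y + y ^ 2)
  have h3 : q * y ^ 2 ≤ y ^ 2 := by nlinarith [sq_nonneg y]
  nlinarith

/-- Exponential Markov inequality for the coefficients of a polynomial. -/
lemma sum_filter_abs_coeff_le {N : ℕ} {f : ℝ[X]} (hf : f.natDegree < N) (h b : ℝ) :
    ∑ j ∈ (Finset.range N).filter (fun j : ℕ => b ≤ h * j), |f.coeff j|
      ≤ Real.exp (-b) * wnorm (Real.exp h) f := by
  rw [wnorm_eq_sum hf, Finset.mul_sum]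
  refine (Finset.sum_le_sum fun j hj => ?_).trans
    (Finset.sum_le_sum_of_subset_of_nonneg (Finset.filter_subset _ _) fun j _ _ => by positivity)
  have hj' := (Finset.mem_filter.1 hj).2
  rw [← Real.exp_nat_mul, mul_left_comm, ← Real.exp_add]
  have : 1 ≤ Real.exp (-b + j * h) := Real.one_le_exp (by linarith)
  nlinarith [abs_nonneg (f.coeff j)]

/-- Exponential Markov with r = e^h; the sign of h selects the side. Since κ² is the Bernoulli
moment generating function at 2h, κ^t ≤ exp(hqt + 2h²t), and |h| = a/(4t) turns the exponent
−a²/(4t) + 2h²t into −a²/(8t). -/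
lemma sum_tail_one_sided_le (hp : 0 < p) (hq : 0 < q) (hpq : p + q = 1)
    (hl : |lam| ≤ 1 / 100) {t : ℕ} (ht : 1 ≤ t) {a h : ℝ} (hat : a ≤ t)
    (hh : |h| = a / (4 * t)) :
    ∑ j ∈ (Finset.range (t + 1)).filter (fun j : ℕ => h * (q * t) + a ^ 2 / (4 * t) ≤ h * j),
        |(walkPoly p q lam t - bernPoly p q ^ t).coeff j|
      ≤ 48 * |lam| * Real.exp (-a ^ 2 / (8 * t)) := by
  have ht0 : (0:ℝ) < t := by exact_mod_cast ht
  have hdeg : (walkPoly p q lam t - bernPoly p q ^ t).natDegree < t + 1 :=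
    Nat.lt_succ_of_le ((natDegree_sub_le _ _).trans
      (max_le (natDegree_walkPoly_le t) (natDegree_bernPoly_pow_le p q t)))
  have hh1 : |h| ≤ 1 / 4 := by
    rw [hh, div_le_iff₀ (by positivity)]; linarith
  have hr2 : Real.exp h ≤ 2 := by
    have := (abs_le.1 (Real.abs_exp_sub_one_sub_id_le (by linarith : |h| ≤ 1))).2
    nlinarith [abs_le.1 hh1]
  have hr1 : 1 / 2 ≤ Real.exp h := by
    have := Real.add_one_le_exp h
    linarith [(abs_le.1 hh1).1]
  have hκ : √(p + q * Real.exp h ^ 2) ^ t ≤ Real.exp (h * (q * t) + 2 * h ^ 2 * t) := by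
    have h1 : p + q * Real.exp h ^ 2 ≤ Real.exp (q * (2 * h) + (2 * h) ^ 2) := by
      rw [← Real.exp_nat_mul]
      exact two_point_mgf_le hp.le hq.le hpq (by rw [abs_mul]; norm_num; linarith)
    have h2 : √(p + q * Real.exp h ^ 2) ≤ Real.exp (q * h + 2 * h ^ 2) := by
      refine Real.sqrt_le_iff.2 ⟨(Real.exp_pos _).le, h1.trans_eq ?_⟩
      rw [← Real.exp_nat_mul]; congr 1; push_cast; ring
    refine (pow_le_pow_left₀ (Real.sqrt_nonneg _) h2 t).trans_eq ?_
    rw [← Real.exp_nat_mul]; congr 1; ring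
  refine (sum_filter_abs_coeff_le hdeg h _).trans ?_
  have h3 := wnorm_walkPoly_sub_pow_le hp hq hpq hl hr1 hr2 ht
  have hsq : h ^ 2 = (a / (4 * t)) ^ 2 := by rw [← sq_abs, hh]
  calc _ ≤ Real.exp (-(h * (q * t) + a ^ 2 / (4 * t)))
          * (48 * |lam| * Real.exp (h * (q * t) + 2 * h ^ 2 * t)) := by
        refine mul_le_mul_of_nonneg_left (h3.trans ?_) (Real.exp_pos _).le
        exact mul_le_mul_of_nonneg_left hκ (by positivity)
    _ = 48 * |lam| * Real.exp (-(h * (q * t) + a ^ 2 / (4 * t))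
          + (h * (q * t) + 2 * h ^ 2 * t)) := by
        rw [Real.exp_add (-_)]; ring
    _ = _ := by
        congr 2
        rw [hsq]; field_simp; ring

/-- The label sum of a sticky walk is close to a binomial variable, with Gaussian tails. -/
lemma sum_tail_le (hp : 0 < p) (hq : 0 < q) (hpq : p + q = 1) (hl : |lam| ≤ 1 / 100)
    {t : ℕ} (ht : 1 ≤ t) {a : ℝ} (ha : 0 ≤ a) :
    ∑ j ∈ (Finset.range (t + 1)).filter (fun j : ℕ => a ≤ |(j:ℝ) - q * t|),
        |(walkPoly p q lam t - bernPoly p q ^ t).coeff j|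
      ≤ 96 * |lam| * Real.exp (-a ^ 2 / (8 * t)) := by
  have ht0 : (0:ℝ) < t := by exact_mod_cast ht
  rcases le_or_gt a t with hat | hat
  · have h1 := sum_tail_one_sided_le (lam := lam) hp hq hpq hl ht (h := a / (4 * t)) hat
      (abs_of_nonneg (by positivity))
    have h2 := sum_tail_one_sided_le (lam := lam) hp hq hpq hl ht (h := -(a / (4 * t))) hat
      (by rw [abs_neg, abs_of_nonneg (by positivity)])
    refine le_trans ?_ ((add_le_add h1 h2).trans_eq (by ring))
    rw [← Finset.sum_union_inter]
    refine (Finset.sum_le_sum_of_subset_of_nonneg ?_ fun _ _ _ => abs_nonneg _).trans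
      (le_add_of_nonneg_right (Finset.sum_nonneg fun _ _ => abs_nonneg _))
    intro j hj
    obtain ⟨hj1, hj2⟩ := Finset.mem_filter.1 hj
    have hc : 0 ≤ a / (4 * t) := by positivity
    have e : a ^ 2 / (4 * t) = a / (4 * t) * a := by ring
    rw [Finset.mem_union, Finset.mem_filter, Finset.mem_filter, e]
    rcases le_abs'.1 hj2 with h | h
    · exact Or.inr ⟨hj1, by nlinarith⟩
    · exact Or.inl ⟨hj1, by nlinarith⟩
  -- For a > t the tail is empty: both j and qt lie in [0, t].
  · rw [Finset.filter_eq_empty_iff.2, Finset.sum_empty]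
    · positivity
    · intro j hj
      have hj' : (j : ℝ) ≤ t := by exact_mod_cast Nat.lt_succ_iff.1 (Finset.mem_range.1 hj)
      have hj0 : (0 : ℝ) ≤ j := by positivity
      rw [not_le]
      refine lt_of_le_of_lt (abs_le.2 ⟨?_, ?_⟩) hat <;> nlinarith

end WalkBounds

/-! ### Mean and variance -/

section Moments

open Polynomial

variable {p q lam : ℝ}

lemma gapPoly_eval_one (hpq : p + q = 1) (hl : lam ≠ 1) (n : ℕ) :
    (gapPoly p q lam n).eval 1 = (1 - lam ^ n) / (1 - lam) ∧ (walkPoly p q lam n).eval 1 = 1 := by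
  have h1 : 1 - lam ≠ 0 := sub_ne_zero.2 hl.symm
  induction n with
  | zero => simp
  | succ n ih =>
    obtain ⟨h2, h3⟩ := ih
    simp only [gapPoly_succ, walkPoly_succ, bernPoly, diffPoly, eval_add, eval_mul, eval_C,
      eval_X, h2, h3, eval_pow, eval_sub, eval_one]
    constructor
    · rw [mul_one, add_comm q p, hpq]; field_simp; ring
    · linear_combination hpq

lemma walkPoly_derivative_eval_one (hpq : p + q = 1) (hl : lam ≠ 1) (n : ℕ) :
    (derivative (walkPoly p q lam n)).eval 1 = q * n := by
  induction n with
  | zero => simp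
  | succ n ih =>
    simp only [walkPoly_succ, bernPoly, diffPoly, derivative_add, derivative_mul, derivative_C,
      derivative_X, derivative_pow, derivative_sub, derivative_one, eval_add, eval_mul, eval_C,
      eval_X, eval_pow, eval_sub, eval_one, ih, (gapPoly_eval_one hpq hl n).2]
    push_cast
    simp
    linear_combination (q * n) * hpq

/-- As Δ vanishes to second order at 1, the correction λΔD_n enters the second derivative there only
through 2pqλD_n(1), and D_n(1) is a geometric sum. -/
lemma walkPoly_variance (hpq : p + q = 1) (hl : lam ≠ 1) (n : ℕ) :
    (derivative (derivative (walkPoly p q lam n))).eval 1 + q * n - (q * n) ^ 2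
      = p * q * (n * (1 + lam) / (1 - lam) - 2 * lam * (1 - lam ^ n) / (1 - lam) ^ 2) := by
  have h1 : 1 - lam ≠ 0 := sub_ne_zero.2 hl.symm
  induction n with
  | zero => simp
  | succ n ih =>
    obtain ⟨h2, h3⟩ := gapPoly_eval_one hpq hl n
    have h4 := walkPoly_derivative_eval_one hpq hl n
    have e : (derivative (derivative (walkPoly p q lam (n + 1)))).eval 1
        = (derivative (derivative (walkPoly p q lam n))).eval 1 + 2 * q * (q * n)
          + 2 * (p * q) * lam * ((1 - lam ^ n) / (1 - lam)) := by
      simp only [walkPoly_succ, bernPoly, diffPoly, derivative_add, derivative_mul, derivative_C,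
        derivative_X, derivative_pow, derivative_sub, derivative_one, eval_add, eval_mul, eval_C,
        eval_X, eval_pow, eval_sub, eval_one, h2, h4]
      simp
      linear_combination ((derivative (derivative (walkPoly p q lam n))).eval 1) * hpq
    rw [e]
    have e2 : p * q * (((n + 1 : ℕ) : ℝ) * (1 + lam) / (1 - lam)
          - 2 * lam * (1 - lam ^ (n + 1)) / (1 - lam) ^ 2)
        = p * q * (n * (1 + lam) / (1 - lam) - 2 * lam * (1 - lam ^ n) / (1 - lam) ^ 2)
          + p * q * (1 + 2 * lam * ((1 - lam ^ n) / (1 - lam))) := by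
      push_cast; field_simp; ring
    rw [e2, ← ih]
    push_cast
    have e3 : p * q = q - q ^ 2 := by linear_combination q * hpq
    linear_combination (-1 : ℝ) * e3

end Moments

/-! ### Decay of the characteristic function -/

section Fourier

open Polynomial

variable {p q lam : ℝ}

/-- Here A = |F|, B = √s|D|, l = |λ|. Weighting B² by 1/2 makes the sA² passed on to B' cancel only
half of the loss sA² in A'. The cross terms 3l√s·AB are split by completing a square, which uses
another sA²/4 and a multiple of l²B², negligible for l ≤ 1/100. -/
lemma energy_contraction {A B A' B' s l : ℝ} (hA : 0 ≤ A) (hB : 0 ≤ B) (hA' : 0 ≤ A')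
    (hB' : 0 ≤ B') (hs0 : 0 ≤ s) (hs1 : s ≤ 1) (hl0 : 0 ≤ l) (hl : l ≤ 1 / 100)
    (h1 : A' ≤ √(1 - s) * A + l * (√s * B)) (h2 : B' ≤ √s * A + l * B) :
    A' ^ 2 + B' ^ 2 / 2 ≤ (1 - s / 4) * (A ^ 2 + B ^ 2 / 2) := by
  have g1 := pow_le_pow_left₀ hA' h1 2
  have g2 := pow_le_pow_left₀ hB' h2 2
  have hc : √(1 - s) ^ 2 = 1 - s := Real.sq_sqrt (by linarith)
  have hd : √s ^ 2 = s := Real.sq_sqrt hs0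
  have hc1 : √(1 - s) ≤ 1 := Real.sqrt_le_one.2 (by linarith)
  set c := √(1 - s)
  set d := √s with hd'
  have hd0 : 0 ≤ d := Real.sqrt_nonneg _
  have k1 : (c * A + l * (d * B)) ^ 2 ≤ (1 - s) * A ^ 2 + 2 * (l * d * (A * B)) + l ^ 2 * s * B ^ 2 := by
    have : c * (l * d * (A * B)) ≤ 1 * (l * d * (A * B)) :=
      mul_le_mul_of_nonneg_right hc1 (by positivity)
    calc _ = c ^ 2 * A ^ 2 + 2 * (c * (l * d * (A * B))) + l ^ 2 * d ^ 2 * B ^ 2 := by ring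
      _ ≤ _ := by rw [hc, hd]; linarith
  have k2 : (d * A + l * B) ^ 2 = s * A ^ 2 + 2 * (l * d * (A * B)) + l ^ 2 * B ^ 2 := by
    calc _ = d ^ 2 * A ^ 2 + 2 * (l * d * (A * B)) + l ^ 2 * B ^ 2 := by ring
      _ = _ := by rw [hd]
  have k3 : 0 ≤ s * A ^ 2 / 4 - 3 * (l * d * (A * B)) + 9 * l ^ 2 * B ^ 2 := by
    calc 0 ≤ (d * A / 2 - 3 * l * B) ^ 2 := sq_nonneg _
      _ = d ^ 2 * A ^ 2 / 4 - 3 * (l * d * (A * B)) + 9 * l ^ 2 * B ^ 2 := by ring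
      _ = _ := by rw [hd]
  have k4 : l ^ 2 ≤ 1 / 10000 := by nlinarith
  have k5 : 0 ≤ B ^ 2 := sq_nonneg _
  have k6 : l ^ 2 * B ^ 2 ≤ 1 / 10000 * B ^ 2 := mul_le_mul_of_nonneg_right k4 k5
  have k7 : s * (l ^ 2 * B ^ 2) ≤ 1 * (l ^ 2 * B ^ 2) :=
    mul_le_mul_of_nonneg_right hs1 (by positivity)
  have k8 : s * B ^ 2 ≤ 1 * B ^ 2 := mul_le_mul_of_nonneg_right hs1 k5
  nlinarith

lemma norm_aeval_walkPoly_sq_le (hp : 0 < p) (hq : 0 < q) (hpq : p + q = 1)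
    (hl : |lam| ≤ 1 / 100) {z : ℂ} (hz : ‖z‖ = 1) (n : ℕ) :
    ‖aeval z (walkPoly p q lam n)‖ ^ 2
      ≤ (1 - p * q * ‖1 - z‖ ^ 2 / 4) ^ n := by
  set s := p * q * ‖1 - z‖ ^ 2 with hs
  have hzz : z.re ^ 2 + z.im ^ 2 = 1 := by
    rw [← Complex.normSq_add_mul_I z.re z.im, Complex.re_add_im, Complex.normSq_eq_norm_sq, hz]
    norm_num
  have h1z : ‖1 - z‖ ^ 2 = 2 - 2 * z.re := by
    rw [← Complex.normSq_eq_norm_sq, Complex.normSq_apply]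
    simp
    linear_combination hzz
  have hre : -1 ≤ z.re := by nlinarith [sq_nonneg z.im]
  have hs0 : 0 ≤ s := by positivity
  have hs1 : s ≤ 1 := by
    rw [hs, h1z]
    nlinarith [sq_nonneg (p - q), mul_pos hp hq]
  have hμ : ‖aeval z (bernPoly p q)‖ = √(1 - s) := by
    rw [eq_comm, Real.sqrt_eq_iff_mul_self_eq (by linarith) (norm_nonneg _), ← sq,
      ← Complex.normSq_eq_norm_sq, Complex.normSq_apply, hs, h1z]
    simp [bernPoly]
    have : p = 1 - q := by linarith
    subst this
    linear_combination (-(q ^ 2)) * hzz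
  have hν : ‖aeval z (bernPoly q p)‖ ≤ 1 := by
    simp only [bernPoly, map_add, map_mul, aeval_C, aeval_X, Complex.coe_algebraMap]
    refine (norm_add_le _ _).trans ?_
    rw [norm_mul, hz, Complex.norm_real, Complex.norm_real, Real.norm_eq_abs, Real.norm_eq_abs,
      abs_of_pos hp, abs_of_pos hq]
    linarith
  have hd : ‖aeval z (diffPoly p q)‖ = √s * √s := by
    rw [Real.mul_self_sqrt hs0, hs]
    simp [diffPoly, abs_of_pos hp, abs_of_pos hq]
  have main : ∀ n, ‖aeval z (walkPoly p q lam n)‖ ^ 2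
      + (√s * ‖aeval z (gapPoly p q lam n)‖) ^ 2 / 2 ≤ (1 - s / 4) ^ n := by
    intro n
    induction n with
    | zero => simp
    | succ n ih =>
      have hsq : 0 ≤ √s := Real.sqrt_nonneg s
      have h := energy_contraction (s := s) (l := |lam|) (norm_nonneg (aeval z (walkPoly p q lam n)))
        (mul_nonneg hsq (norm_nonneg (aeval z (gapPoly p q lam n))))
        (norm_nonneg (aeval z (walkPoly p q lam (n + 1))))
        (mul_nonneg hsq (norm_nonneg (aeval z (gapPoly p q lam (n + 1)))))
        hs0 hs1 (abs_nonneg lam) hl ?_ ?_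
      · refine h.trans ?_
        rw [pow_succ' (1 - s / 4)]
        have h0 : 0 ≤ 1 - s / 4 := by linarith
        exact mul_le_mul_of_nonneg_left ih h0
      · rw [walkPoly_succ, map_add, map_mul, map_mul, map_mul, aeval_C]
        refine (norm_add_le _ _).trans_eq ?_
        rw [norm_mul, norm_mul, norm_mul, hμ, hd, Complex.coe_algebraMap, Complex.norm_real,
          Real.norm_eq_abs]
        ring
      · rw [gapPoly_succ, map_add, map_mul, map_mul, aeval_C]
        have h3 := norm_add_le (aeval z (walkPoly p q lam n))
          ((algebraMap ℝ ℂ) lam * (aeval z (bernPoly q p) * aeval z (gapPoly p q lam n)))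
        rw [norm_mul, norm_mul] at h3
        have h4 : ‖(algebraMap ℝ ℂ) lam‖ = |lam| := by simp
        rw [h4] at h3
        set G := ‖aeval z (gapPoly p q lam n)‖
        have hG : 0 ≤ G := norm_nonneg _
        have h5 : |lam| * (‖aeval z (bernPoly q p)‖ * G) ≤ |lam| * (1 * G) := by gcongr
        calc _ ≤ √s * (‖aeval z (walkPoly p q lam n)‖ + |lam| * (1 * G)) :=
              mul_le_mul_of_nonneg_left (by linarith) hsq
          _ = _ := by ring
  exact le_trans (le_add_of_nonneg_right (by positivity)) (main n)

lemma norm_aeval_walkPoly_le (hp : 0 < p) (hq : 0 < q) (hpq : p + q = 1)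
    (hl : |lam| ≤ 1 / 100) {θ : ℝ} (hθ : |θ| ≤ Real.pi) (n : ℕ) :
    ‖aeval (Complex.exp (-(Complex.I * θ))) (walkPoly p q lam n)‖
      ≤ Real.exp (-(p * q * n * θ ^ 2) / 20) := by
  set z := Complex.exp (-(Complex.I * θ)) with hz
  have hz' : z = Complex.exp ((-θ : ℝ) * Complex.I) := by rw [hz]; congr 1; push_cast; ring
  have hz1 : ‖z‖ = 1 := by rw [hz', Complex.norm_exp_ofReal_mul_I]
  have h1z : ‖1 - z‖ ^ 2 = 2 - 2 * Real.cos θ := by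
    rw [← Complex.normSq_eq_norm_sq, Complex.normSq_apply, hz', Complex.sub_re, Complex.sub_im,
      Complex.exp_ofReal_mul_I_re, Complex.exp_ofReal_mul_I_im]
    simp
    linear_combination Real.sin_sq_add_cos_sq θ
  have h := norm_aeval_walkPoly_sq_le (lam := lam) hp hq hpq hl hz1 n
  have hcos := Real.cos_le_one_sub_mul_cos_sq hθ
  -- Gives 2 − 2cos θ ≥ 4θ²/π² ≥ 4θ²/10; the factor 1/4 in the contraction and the final square root
  -- lead to 1/20.
  have hpi : Real.pi ^ 2 ≤ 10 := by
    have := Real.pi_lt_d4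
    nlinarith [Real.pi_pos]
  have h1 : 4 / 10 * θ ^ 2 ≤ ‖1 - z‖ ^ 2 := by
    have : (2 / 10 : ℝ) ≤ 2 / Real.pi ^ 2 := by gcongr
    rw [h1z]
    nlinarith [mul_le_mul_of_nonneg_right this (sq_nonneg θ)]
  have hpq0 := mul_pos hp hq
  have hle : p * q * ‖1 - z‖ ^ 2 ≤ 4 := by
    have : ‖1 - z‖ ^ 2 ≤ 4 := by rw [h1z]; linarith [Real.neg_one_le_cos θ]
    nlinarith [norm_nonneg (1 - z)]
  have h2 : (1 - p * q * ‖1 - z‖ ^ 2 / 4) ^ n ≤ Real.exp (-(p * q * θ ^ 2) / 10) ^ n := by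
    refine pow_le_pow_left₀ (by linarith) ?_ n
    have h3 := Real.add_one_le_exp (-(p * q * θ ^ 2) / 10)
    nlinarith
  refine abs_le_of_sq_le_sq' ((h.trans h2).trans_eq ?_) (Real.exp_pos _).le |>.2
  rw [← Real.exp_nat_mul, ← Real.exp_nat_mul]
  congr 1
  push_cast
  ring

end Fourier

/-! ### From polynomials to measures on ℤ -/

section PolyMeasure

open Polynomial
open scoped ENNReal

/-- The measure on `ℤ` giving mass `f_j` to `j`, for a polynomial `f` with nonnegative
coefficients. -/
noncomputable def polyMeasure (f : ℝ[X]) : Measure ℤ :=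
  Measure.sum fun j : ℕ => ENNReal.ofReal (f.coeff j) • Measure.dirac (j : ℤ)

lemma lintegral_polyMeasure (f : ℝ[X]) (h : ℤ → ℝ≥0∞) :
    ∫⁻ j, h j ∂(polyMeasure f) = ∑' j : ℕ, ENNReal.ofReal (f.coeff j) * h j := by
  simp [polyMeasure, lintegral_sum_measure]

lemma polyMeasure_eq_sum {f : ℝ[X]} {N : ℕ} (hN : f.natDegree < N) :
    polyMeasure f
      = ∑ j ∈ Finset.range N, ENNReal.ofReal (f.coeff j) • Measure.dirac (j : ℤ) := by
  ext s hs
  rw [polyMeasure, Measure.sum_apply _ hs, Measure.finsetSum_apply]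
  refine tsum_eq_sum fun j hj => ?_
  rw [coeff_eq_zero_of_natDegree_lt (by simp at hj; omega)]
  simp

lemma polyMeasure_singleton (f : ℝ[X]) (j : ℤ) :
    polyMeasure f {j} = if 0 ≤ j then ENNReal.ofReal (f.coeff j.toNat) else 0 := by
  rw [polyMeasure, Measure.sum_apply _ (measurableSet_singleton j)]
  split_ifs with h
  · lift j to ℕ using h
    rw [tsum_eq_single j]
    · simp
    · intro b hb
      simp [hb]
  · refine ENNReal.tsum_eq_zero.2 fun b => ?_
    have : (b : ℤ) ≠ j := by omega
    simp [this]

lemma polyMeasure_real_singleton {f : ℝ[X]} (hf : ∀ j, 0 ≤ f.coeff j) (j : ℤ) :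
    (polyMeasure f).real {j} = if 0 ≤ j then f.coeff j.toNat else 0 := by
  rw [measureReal_def, polyMeasure_singleton]
  split_ifs
  · exact ENNReal.toReal_ofReal (hf _)
  · rfl

lemma isProbabilityMeasure_polyMeasure {f : ℝ[X]} (hf : ∀ j, 0 ≤ f.coeff j) (h1 : f.eval 1 = 1) :
    IsProbabilityMeasure (polyMeasure f) := by
  constructor
  rw [polyMeasure_eq_sum (Nat.lt_succ_self _), Measure.finsetSum_apply]
  simp only [Measure.smul_apply, measure_univ, smul_eq_mul, mul_one]
  rw [← ENNReal.ofReal_sum_of_nonneg fun j _ => hf j]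
  rw [eval_eq_sum_range] at h1
  simp only [one_pow, mul_one] at h1
  rw [h1, ENNReal.ofReal_one]

instance (f : ℝ[X]) : IsFiniteMeasure (polyMeasure f) := by
  constructor
  rw [polyMeasure_eq_sum (Nat.lt_succ_self _), Measure.finsetSum_apply]
  simp [ENNReal.sum_lt_top]

lemma coeff_mul_nonneg {f g : ℝ[X]} (hf : ∀ j, 0 ≤ f.coeff j) (hg : ∀ j, 0 ≤ g.coeff j) (j : ℕ) :
    0 ≤ (f * g).coeff j := by
  rw [coeff_mul]
  exact Finset.sum_nonneg fun _ _ => mul_nonneg (hf _) (hg _)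

lemma coeff_prod_nonneg {ι : Type*} (s : Finset ι) {f : ι → ℝ[X]}
    (hf : ∀ i j, 0 ≤ (f i).coeff j) (j : ℕ) : 0 ≤ (∏ i ∈ s, f i).coeff j := by
  classical
  induction s using Finset.induction_on generalizing j with
  | empty => rw [Finset.prod_empty, coeff_one]; split_ifs <;> norm_num
  | insert a s ha ih =>
    rw [Finset.prod_insert ha]
    exact coeff_mul_nonneg (hf a) ih j

lemma conv_polyMeasure {f g : ℝ[X]} (hf : ∀ j, 0 ≤ f.coeff j) (hg : ∀ j, 0 ≤ g.coeff j) :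
    (polyMeasure f).conv (polyMeasure g) = polyMeasure (f * g) := by
  refine Measure.ext_of_lintegral _ fun h hh => ?_
  rw [Measure.lintegral_conv hh, lintegral_polyMeasure, lintegral_polyMeasure]
  simp only [lintegral_polyMeasure, coeff_mul]
  have e : ∀ n : ℕ, ENNReal.ofReal (∑ x ∈ Finset.HasAntidiagonal.antidiagonal n, f.coeff x.1 * g.coeff x.2) * h n
      = ∑' x : Finset.HasAntidiagonal.antidiagonal n, ENNReal.ofReal (f.coeff x.1.1)
          * (ENNReal.ofReal (g.coeff x.1.2) * h (x.1.1 + x.1.2)) := by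
    intro n
    rw [ENNReal.ofReal_sum_of_nonneg fun _ _ => mul_nonneg (hf _) (hg _), Finset.sum_mul,
      Finset.tsum_subtype (Finset.HasAntidiagonal.antidiagonal n) fun x : ℕ × ℕ =>
        ENNReal.ofReal (f.coeff x.1) * (ENNReal.ofReal (g.coeff x.2) * h (x.1 + x.2))]
    refine Finset.sum_congr rfl fun x hx => ?_
    have hx' : (x.1 + x.2 : ℤ) = n := by exact_mod_cast Finset.HasAntidiagonal.mem_antidiagonal.1 hx
    rw [ENNReal.ofReal_mul (hf _), hx', mul_assoc]
  simp only [e]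
  rw [← ENNReal.tsum_sigma' fun x : (Σ n : ℕ, Finset.HasAntidiagonal.antidiagonal n) =>
    ENNReal.ofReal (f.coeff x.2.1.1) * (ENNReal.ofReal (g.coeff x.2.1.2)
      * h (x.2.1.1 + x.2.1.2))]
  rw [← Finset.HasAntidiagonal.sigmaAntidiagonalEquivProd.symm.tsum_eq, ENNReal.tsum_prod']
  simp only [← ENNReal.tsum_mul_left]
  rfl

lemma indepSum_polyMeasure {ℓ : ℕ} {f : Fin ℓ → ℝ[X]} (hf : ∀ i j, 0 ≤ (f i).coeff j) :
    indepSum (fun i => polyMeasure (f i)) = polyMeasure (∏ i, f i) := by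
  induction ℓ with
  | zero =>
    rw [indepSum, Measure.pi_of_empty, Measure.map_dirac' (by fun_prop),
      polyMeasure_eq_sum (N := 1) (by simp)]
    simp
  | succ ℓ ih =>
    rw [Fin.prod_univ_succ, ← conv_polyMeasure (hf 0) (fun j => coeff_prod_nonneg _
      (fun i j => hf i.succ j) j), ← ih fun i j => hf i.succ j]
    have hmp := (measurePreserving_piFinSuccAbove (fun i => polyMeasure (f i)) 0).map_eq
    have hprod := Measure.map_prod_map (polyMeasure (f 0))
      (Measure.pi fun i : Fin ℓ => polyMeasure (f i.succ)) measurable_id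
      (show Measurable fun x : Fin ℓ → ℤ => ∑ i, x i by fun_prop)
    rw [Measure.map_id] at hprod
    simp only [Fin.zero_succAbove] at hmp
    rw [indepSum, indepSum, Measure.conv, hprod, Measure.map_map (by fun_prop) (by fun_prop), ← hmp,
      Measure.map_map (by fun_prop) (by fun_prop)]
    congr 1
    ext x
    simp [Fin.sum_univ_succ, Fin.tail]

lemma tsum_int_eq_sum {h : ℤ → ℝ} {N : ℕ} (h0 : ∀ j : ℤ, j < 0 → h j = 0)
    (h1 : ∀ j : ℕ, N ≤ j → h j = 0) : ∑' j : ℤ, h j = ∑ j ∈ Finset.range N, h j := by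
  have e : ∑ j ∈ Finset.range N, h j
      = ∑ j ∈ (Finset.range N).map ⟨((↑) : ℕ → ℤ), Nat.cast_injective⟩, h j := by
    rw [Finset.sum_map]; rfl
  rw [e]
  refine tsum_eq_sum fun j hj => ?_
  rcases lt_or_ge j 0 with hneg | hpos
  · exact h0 j hneg
  · lift j to ℕ using hpos
    refine h1 j ?_
    by_contra hlt
    exact hj (Finset.mem_map.2 ⟨j, Finset.mem_range.2 (not_le.1 hlt), rfl⟩)

lemma tvDist_polyMeasure {f g : ℝ[X]} (hf : ∀ j, 0 ≤ f.coeff j) (hg : ∀ j, 0 ≤ g.coeff j) :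
    tvDist (polyMeasure f) (polyMeasure g) = 1 / 2 * wnorm 1 (f - g) := by
  rw [tvDist, wnorm_eq_sum (Nat.lt_succ_self _)]
  congr 1
  simp only [polyMeasure_real_singleton hf, polyMeasure_real_singleton hg]
  rw [tsum_int_eq_sum (N := (f - g).natDegree + 1)]
  · simp
  · intro j hj
    simp [not_le.2 hj]
  · intro j hj
    have := coeff_eq_zero_of_natDegree_lt (p := f - g) (n := j) (by omega)
    rw [coeff_sub] at this
    simp [this]

lemma integrable_polyMeasure {E : Type*} [NormedAddCommGroup E] (f : ℝ[X]) (h : ℤ → E) :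
    Integrable h (polyMeasure f) := by
  rw [polyMeasure_eq_sum (Nat.lt_succ_self _), integrable_finsetSum_measure]
  intro j _
  exact (integrable_dirac (by simp)).smul_measure ENNReal.ofReal_ne_top

lemma integral_polyMeasure {E : Type*} [NormedAddCommGroup E] [NormedSpace ℝ E] [CompleteSpace E]
    {f : ℝ[X]} (hf : ∀ j, 0 ≤ f.coeff j) (h : ℤ → E) :
    ∫ j, h j ∂(polyMeasure f) = ∑ j ∈ Finset.range (f.natDegree + 1), f.coeff j • h j := by
  rw [polyMeasure_eq_sum (Nat.lt_succ_self _), integral_finsetSum_measure]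
  · refine Finset.sum_congr rfl fun j _ => ?_
    rw [integral_smul_measure, integral_dirac, ENNReal.toReal_ofReal (hf j)]
  · intro j _
    exact (integrable_dirac (by simp)).smul_measure ENNReal.ofReal_ne_top

lemma memLp_polyMeasure (f : ℝ[X]) : MemLp (fun j : ℤ => (j : ℝ)) 2 (polyMeasure f) :=
  (memLp_two_iff_integrable_sq (by fun_prop)).2 (integrable_polyMeasure f _)

lemma integral_id_polyMeasure {f : ℝ[X]} (hf : ∀ j, 0 ≤ f.coeff j) :
    ∫ j, (j : ℝ) ∂(polyMeasure f) = (derivative f).eval 1 := by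
  rw [integral_polyMeasure hf, derivative_eval, f.sum_over_range (by simp)]
  simp

lemma variance_polyMeasure {f : ℝ[X]} (hf : ∀ j, 0 ≤ f.coeff j) (h1 : f.eval 1 = 1) :
    variance (fun j : ℤ => (j : ℝ)) (polyMeasure f)
      = (derivative (derivative f)).eval 1 + (derivative f).eval 1
        - (derivative f).eval 1 ^ 2 := by
  have := isProbabilityMeasure_polyMeasure hf h1
  rw [variance_eq_sub (memLp_polyMeasure f), integral_id_polyMeasure hf]
  congr 1
  simp only [Pi.pow_apply]
  rw [integral_polyMeasure hf]
  have e : (derivative (derivative f)).eval 1 + (derivative f).eval 1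
      = (derivative (X * derivative f)).eval 1 := by
    simp [derivative_mul]; ring
  have e2 : X * derivative f = ∑ j ∈ Finset.range (f.natDegree + 1), monomial j (f.coeff j * j) := by
    conv_lhs => rw [f.as_sum_range]
    rw [derivative_sum, Finset.mul_sum]
    refine Finset.sum_congr rfl fun j _ => ?_
    rw [derivative_monomial]
    cases j with
    | zero => simp
    | succ j => rw [X_mul_monomial]; simp
  rw [e, e2, derivative_sum, eval_finsetSum]
  refine Finset.sum_congr rfl fun j _ => ?_
  rw [derivative_monomial, eval_monomial]
  simp; ring

lemma integral_exp_polyMeasure {f : ℝ[X]} (hf : ∀ j, 0 ≤ f.coeff j) (θ : ℝ) :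
    ∫ j : ℤ, Complex.exp (-(Complex.I * θ * j)) ∂(polyMeasure f)
      = aeval (Complex.exp (-(Complex.I * θ))) f := by
  rw [integral_polyMeasure hf, aeval_eq_sum_range]
  refine Finset.sum_congr rfl fun j _ => ?_
  rw [← Complex.exp_nat_mul]
  congr 2
  push_cast
  ring

lemma map_cast_binomial_real (t : ℕ) (q : I) (j : ℤ) :
    ((binomial t q).map (Nat.cast : ℕ → ℤ)).real {j}
      = if 0 ≤ j then (bernPoly (1 - q) q ^ t).coeff j.toNat else 0 := by
  split_ifs with h
  · lift j to ℕ using h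
    rw [map_cast_binomial_real_singleton, bernPoly, coeff_linear_pow]
    simp; ring
  · rw [map_measureReal_apply (by fun_prop) (measurableSet_singleton j)]
    convert measureReal_empty
    ext k
    simp
    omega

end PolyMeasure

/-! ### Identification of the label sum law -/

section StickyLaw

open Polynomial
open scoped ENNReal

variable {p q lam : ℝ}

/-- Generating functions of the label sum of a sticky walk, restricted to the final label. -/
noncomputable def endPoly (p q lam : ℝ) (n : ℕ) : Fin 2 → ℝ[X] :=
  ![C p * (walkPoly p q lam n + C q * ((1 - X) * gapPoly p q lam n)),
    C q * (walkPoly p q lam n - C p * ((1 - X) * gapPoly p q lam n))]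

lemma endPoly_zero : endPoly p q lam 0 = ![C p, C q] := by simp [endPoly]

lemma endPoly_succ_zero (hpq : p + q = 1) (n : ℕ) : endPoly p q lam (n + 1) 0
    = C (p + q * lam) * endPoly p q lam n 0 + C (p - p * lam) * endPoly p q lam n 1 := by
  have h : C q = 1 - C p := by rw [← C_1, ← C_sub]; congr 1; linarith
  simp only [endPoly, walkPoly_succ, gapPoly_succ, bernPoly, diffPoly, Matrix.cons_val_zero,
    Matrix.cons_val_one, C_add, C_sub, C_mul, h]
  ring

lemma endPoly_succ_one (hpq : p + q = 1) (n : ℕ) : endPoly p q lam (n + 1) 1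
    = X * (C (q - q * lam) * endPoly p q lam n 0 + C (q + p * lam) * endPoly p q lam n 1) := by
  have h : C q = 1 - C p := by rw [← C_1, ← C_sub]; congr 1; linarith
  simp only [endPoly, walkPoly_succ, gapPoly_succ, bernPoly, diffPoly, Matrix.cons_val_zero,
    Matrix.cons_val_one, C_add, C_sub, C_mul, h]
  ring

lemma endPoly_add (hpq : p + q = 1) (n : ℕ) :
    endPoly p q lam n 0 + endPoly p q lam n 1 = walkPoly p q lam n := by
  have h : C q = 1 - C p := by rw [← C_1, ← C_sub]; congr 1; linarith
  simp only [endPoly, Matrix.cons_val_zero, Matrix.cons_val_one, h]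
  ring

/-- The recurrence for F and D has terms of both signs; splitting by the final label instead yields
one whose coefficients are transition probabilities. -/
lemma endPoly_coeff_nonneg (hpq : p + q = 1) (hp : 0 ≤ p) (hq : 0 ≤ q)
    (hT : IsRandomWalkMatrix (stickyTransition p q lam)) (n : ℕ) (b : Fin 2) (j : ℕ) :
    0 ≤ (endPoly p q lam n b).coeff j := by
  have h00 := (hT.1 0 0).1
  have h01 := (hT.1 0 1).1
  have h10 := (hT.1 1 0).1
  have h11 := (hT.1 1 1).1
  simp only [stickyTransition, Matrix.of_apply, Matrix.cons_val_zero, Matrix.cons_val_one,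
    Matrix.cons_val'] at h00 h01 h10 h11
  induction n generalizing b j with
  | zero =>
    rw [endPoly_zero]
    fin_cases b <;> simp [coeff_C] <;> split_ifs <;> first | assumption | exact le_rfl
  | succ n ih =>
    fin_cases b
    · simp only [Fin.zero_eta, endPoly_succ_zero hpq, coeff_add, coeff_C_mul]
      exact add_nonneg (mul_nonneg h00 (ih _ _)) (mul_nonneg h01 (ih _ _))
    · simp only [Fin.mk_one, endPoly_succ_one hpq]
      cases j with
      | zero => simp
      | succ j =>
        simp only [coeff_X_mul, coeff_add, coeff_C_mul]
        exact add_nonneg (mul_nonneg h10 (ih _ _)) (mul_nonneg h11 (ih _ _))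

lemma walkPoly_coeff_nonneg (hpq : p + q = 1) (hp : 0 ≤ p) (hq : 0 ≤ q)
    (hT : IsRandomWalkMatrix (stickyTransition p q lam)) (n j : ℕ) :
    0 ≤ (walkPoly p q lam n).coeff j := by
  rw [← endPoly_add hpq, coeff_add]
  exact add_nonneg (endPoly_coeff_nonneg hpq hp hq hT _ _ _)
    (endPoly_coeff_nonneg hpq hp hq hT _ _ _)

lemma PMF.tsum_bind_mul {α β : Type*} (P : PMF α) (K : α → PMF β) (h : β → ℝ≥0∞) :
    ∑' b, P.bind K b * h b = ∑' a, P a * ∑' b, K a b * h b := by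
  simp only [PMF.bind_apply, ← ENNReal.tsum_mul_right, ← ENNReal.tsum_mul_left, mul_assoc]
  exact ENNReal.tsum_comm

lemma PMF.tsum_map_mul {α β : Type*} (P : PMF α) (f : α → β) (h : β → ℝ≥0∞) :
    ∑' b, P.map f b * h b = ∑' a, P a * h (f a) := by
  rw [← PMF.bind_pure_comp, PMF.tsum_bind_mul]
  refine tsum_congr fun a => ?_
  rw [tsum_eq_single (f a)]
  · simp
  · intro b hb
    simp [hb]

lemma sum_mul_comp_label {V : Type*} [Fintype V] (val : V → Fin 2) (c : V → ℝ≥0∞)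
    (k : Fin 2 → ℝ≥0∞) :
    ∑ v, c v * k (val v) = ∑ b, (∑ v with val v = b, c v) * k b := by
  rw [← Finset.sum_fiberwise Finset.univ val]
  refine Finset.sum_congr rfl fun b _ => ?_
  rw [Finset.sum_mul]
  refine Finset.sum_congr rfl fun v hv => ?_
  rw [(Finset.mem_filter.1 hv).2]

/-- A walk whose labels form a sticky two-state walk. -/
lemma tsum_walkLaw_mul {V : Type*} [Fintype V] (init : PMF V) (W : Matrix V V ℝ)
    (hW : IsRandomWalkMatrix W) (val : V → Fin 2) (hpq : p + q = 1) (hp : 0 ≤ p) (hq : 0 ≤ q)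
    (hT : IsRandomWalkMatrix (stickyTransition p q lam))
    (hinit : ∀ b, ∑ v with val v = b, init v = ENNReal.ofReal (![p, q] b))
    (hstep : ∀ v b, ∑ w with val w = b, W w v = stickyTransition p q lam b (val v))
    (n : ℕ) (h : ℤ → Fin 2 → ℝ≥0∞) :
    ∑' v, walkLaw init W hW (n + 1) v
        * h (∑ i, ((val (v i) : ℕ) : ℤ)) (val (v (Fin.last n)))
      = ∑ b, ∑' j : ℕ, ENNReal.ofReal ((endPoly p q lam (n + 1) b).coeff j) * h j b := by
  induction n generalizing h with
  | zero =>
    rw [walkLaw, PMF.tsum_map_mul, tsum_fintype]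
    have e : ∀ v, ∑ _i : Fin (0 + 1), ((val v : ℕ) : ℤ) = ((val v : ℕ) : ℤ) := fun v => by simp
    simp only [e]
    rw [sum_mul_comp_label val init fun b => h ((b : ℕ) : ℤ) b]
    simp only [hinit, Fin.sum_univ_two, zero_add, endPoly_succ_zero hpq, endPoly_succ_one hpq,
      endPoly_zero, Matrix.cons_val_zero, Matrix.cons_val_one, ← C_mul, ← C_add]
    -- Stationarity of p: `endPoly` at 0 is the initial law with no label counted, and one
    -- transition then produces the first counted label with the same law.
    have e0 : (p + q * lam) * p + (p - p * lam) * q = p := by linear_combination p * hpq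
    have e1 : (q - q * lam) * p + (q + p * lam) * q = q := by linear_combination q * hpq
    rw [e0, e1, tsum_eq_single 0, tsum_eq_single 1]
    · simp
    · intro j hj
      rw [mul_comm X, coeff_C_mul_X, if_neg hj]; simp
    · intro j hj
      rw [coeff_C, if_neg hj]; simp
  | succ n ih =>
    have hsum : ∀ (v : Fin (n + 1) → V),
        ∑' w, (stepLaw W hW (v (Fin.last n))).map (fun w => (Fin.snoc v w : Fin (n + 2) → V)) w
          * h (∑ i, ((val (w i) : ℕ) : ℤ)) (val (w (Fin.last (n + 1))))
        = ∑ b, ENNReal.ofReal (stickyTransition p q lam b (val (v (Fin.last n))))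
          * h (∑ i, ((val (v i) : ℕ) : ℤ) + ((b : ℕ) : ℤ)) b := by
      intro v
      rw [PMF.tsum_map_mul, tsum_fintype]
      simp only [Fin.sum_univ_castSucc (n := n + 1), Fin.snoc_castSucc, Fin.snoc_last]
      rw [sum_mul_comp_label val _
        fun b => h (∑ i, ((val (v i) : ℕ) : ℤ) + ((b : ℕ) : ℤ)) b]
      refine Finset.sum_congr rfl fun b _ => ?_
      rw [← hstep, ENNReal.ofReal_sum_of_nonneg fun w _ => (hW.1 w _).1]
      rfl
    rw [walkLaw, PMF.tsum_bind_mul]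
    simp only [hsum]
    rw [ih fun s c => ∑ b, ENNReal.ofReal (stickyTransition p q lam b c)
      * h (s + ((b : ℕ) : ℤ)) b]
    have hu := endPoly_coeff_nonneg hpq hp hq hT (n + 1)
    have h00 := (hT.1 0 0).1
    have h01 := (hT.1 0 1).1
    have h10 := (hT.1 1 0).1
    have h11 := (hT.1 1 1).1
    simp only [stickyTransition, Matrix.of_apply, Matrix.cons_val_zero, Matrix.cons_val_one,
      Matrix.cons_val'] at h00 h01 h10 h11
    simp only [Fin.sum_univ_two, endPoly_succ_zero hpq (n + 1), endPoly_succ_one hpq (n + 1)]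
    rw [tsum_eq_zero_add' (f := fun j => ENNReal.ofReal ((X * _ : ℝ[X]).coeff j) * h (j : ℤ) 1)
      ENNReal.summable]
    simp only [coeff_X_mul, coeff_add, coeff_C_mul, mul_coeff_zero, coeff_X_zero, zero_mul,
      ENNReal.ofReal_zero, zero_add]
    rw [← ENNReal.tsum_add, ← ENNReal.tsum_add]
    refine tsum_congr fun j => ?_
    rw [ENNReal.ofReal_add (mul_nonneg h00 (hu _ _)) (mul_nonneg h01 (hu _ _)),
      ENNReal.ofReal_add (mul_nonneg h10 (hu _ _)) (mul_nonneg h11 (hu _ _)),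
      ENNReal.ofReal_mul h00, ENNReal.ofReal_mul h01, ENNReal.ofReal_mul h10,
      ENNReal.ofReal_mul h11]
    simp only [stickyTransition, Matrix.of_apply, Matrix.cons_val_zero, Matrix.cons_val_one,
      Matrix.cons_val']
    simp
    ring

/-- The label sum of a walk whose labels form a sticky two-state walk. -/
lemma labelSumLaw_eq_polyMeasure {V : Type*} [Fintype V] (init : PMF V) (W : Matrix V V ℝ)
    (hW : IsRandomWalkMatrix W) (val : V → Fin 2) (hpq : p + q = 1) (hp : 0 ≤ p) (hq : 0 ≤ q)
    (hT : IsRandomWalkMatrix (stickyTransition p q lam))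
    (hinit : ∀ b, ∑ v with val v = b, init v = ENNReal.ofReal (![p, q] b))
    (hstep : ∀ v b, ∑ w with val w = b, W w v = stickyTransition p q lam b (val v)) (t : ℕ) :
    labelSumLaw init W hW val t = polyMeasure (walkPoly p q lam t) := by
  cases t with
  | zero =>
    rw [labelSumLaw, walkLaw, PMF.pure_map, PMF.toMeasure_pure,
      polyMeasure_eq_sum (N := 1) (by simp)]
    simp
  | succ n =>
    ext s hs
    rw [labelSumLaw, PMF.toMeasure_apply _ hs, ← lintegral_indicator_one hs,
      lintegral_polyMeasure]
    have e : ∀ x, s.indicator (PMF.map (fun v => ∑ i, ((val (v i) : ℕ) : ℤ))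
        (walkLaw init W hW (n + 1))) x = PMF.map (fun v => ∑ i, ((val (v i) : ℕ) : ℤ))
        (walkLaw init W hW (n + 1)) x * s.indicator 1 x := by
      intro x
      by_cases hx : x ∈ s <;> simp [hx]
    simp only [e]
    rw [PMF.tsum_map_mul]
    have := tsum_walkLaw_mul init W hW val hpq hp hq hT hinit hstep n
      fun j _ => s.indicator 1 j
    rw [this, Fin.sum_univ_two, ← ENNReal.tsum_add]
    refine tsum_congr fun j => ?_
    rw [← endPoly_add hpq, coeff_add, ENNReal.ofReal_add (endPoly_coeff_nonneg hpq hp hq hT _ _ _)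
      (endPoly_coeff_nonneg hpq hp hq hT _ _ _), add_mul]

end StickyLaw

/-! ### Sticky matrices are random walk matrices -/

section Sticky

variable {p q lam : ℝ}

lemma stickyTransition_sum (hpq : p + q = 1) (b : Fin 2) :
    ∑ b', stickyTransition p q lam b' b = 1 := by
  rw [Fin.sum_univ_two]
  fin_cases b <;> simp [stickyTransition] <;> linarith

lemma isRandomWalkMatrix_of_nonneg {V : Type*} [Fintype V] {W : Matrix V V ℝ}
    (h0 : ∀ v' v, 0 ≤ W v' v) (h1 : ∀ v, ∑ v', W v' v = 1) : IsRandomWalkMatrix W :=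
  ⟨fun v' v => ⟨h0 v' v, (Finset.single_le_sum (f := fun w => W w v) (fun w _ => h0 w v)
    (Finset.mem_univ v')).trans_eq (h1 v)⟩, h1⟩

lemma isRandomWalkMatrix_stickyTransition (hpq : p + q = 1) (hp : 0 ≤ p) (hq : 0 ≤ q)
    (hl : lam ≤ 1) (h0 : 0 ≤ p + q * lam) (h1 : 0 ≤ q + p * lam) :
    IsRandomWalkMatrix (stickyTransition p q lam) := by
  refine isRandomWalkMatrix_of_nonneg (fun b' b => ?_) (stickyTransition_sum hpq)
  fin_cases b' <;> fin_cases b <;> simp [stickyTransition] <;> nlinarith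

section Vertices

variable {V : Type*} [Fintype V] (val : V → Fin 2)

lemma labelCard_pos_of_labelWeight_pos {b : Fin 2} (h : 0 < labelWeight val b) :
    0 < labelCard val b := by
  by_contra h0
  rw [labelWeight, Nat.eq_zero_of_not_pos h0] at h
  simp at h

lemma sum_stickyMatrix_fiber (hw : ∀ b, 0 < labelWeight val b) (v : V) (b : Fin 2) :
    ∑ w with val w = b, stickyMatrix val lam w v
      = stickyTransition (labelWeight val 0) (labelWeight val 1) lam b (val v) := by
  have hb : (labelCard val b : ℝ) ≠ 0 := by
    exact_mod_cast (labelCard_pos_of_labelWeight_pos val (hw b)).ne'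
  have : ∀ w ∈ Finset.univ.filter (fun w => val w = b), stickyMatrix val lam w v
      = stickyTransition (labelWeight val 0) (labelWeight val 1) lam b (val v)
        * (1 / (labelCard val b : ℝ)) := fun w hw => by
    rw [stickyMatrix, (Finset.mem_filter.1 hw).2]
  rw [Finset.sum_congr rfl this, Finset.sum_const, nsmul_eq_mul]
  change (labelCard val b : ℝ) * _ = _
  field_simp

lemma isRandomWalkMatrix_stickyMatrix (hw : ∀ b, 0 < labelWeight val b)
    (hpq : labelWeight val 0 + labelWeight val 1 = 1)
    (hT : IsRandomWalkMatrix (stickyTransition (labelWeight val 0) (labelWeight val 1) lam)) :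
    IsRandomWalkMatrix (stickyMatrix val lam) := by
  refine isRandomWalkMatrix_of_nonneg (fun v' v => ?_) fun v => ?_
  · exact mul_nonneg (hT.1 _ _).1 (by positivity)
  · rw [← Finset.sum_fiberwise Finset.univ val]
    simp only [sum_stickyMatrix_fiber val hw]
    exact stickyTransition_sum hpq _

lemma sum_uniformOfFintype_fiber [Nonempty V] (b : Fin 2) :
    ∑ v with val v = b, PMF.uniformOfFintype V v = ENNReal.ofReal (labelWeight val b) := by
  simp only [PMF.uniformOfFintype_apply, Finset.sum_const, nsmul_eq_mul]
  rw [labelWeight, ENNReal.ofReal_div_of_pos (by exact_mod_cast Fintype.card_pos),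
    ENNReal.ofReal_natCast, ENNReal.ofReal_natCast, div_eq_mul_inv]
  rfl

end Vertices

end Sticky

/-! ### Assembling the discrete normal family -/

section DiscreteNormal

open Polynomial

lemma polyMeasure_bernPoly (p₀ p₁ : I) (hp : (p₀ : ℝ) + p₁ = 1) :
    polyMeasure (bernPoly p₀ p₁) = bernoulliMeasure (1 : ℤ) 0 p₁ := by
  have hdeg : (bernPoly p₀ p₁).natDegree < 2 := by
    have := natDegree_bernPoly_pow_le p₀ p₁ 1
    rw [pow_one] at this
    omega
  rw [polyMeasure_eq_sum hdeg, bernoulliMeasure_def, Finset.sum_range_succ, Finset.sum_range_one,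
    add_comm]
  have e0 : (bernPoly p₀ p₁).coeff 0 = p₀ := by simp [bernPoly]
  have e1 : (bernPoly p₀ p₁).coeff 1 = p₁ := by simp [bernPoly, coeff_C]
  rw [e0, e1]
  have h1 : ENNReal.ofReal (p₁ : ℝ) = (unitInterval.toNNReal p₁ : ENNReal) := by
    rw [ENNReal.ofReal_eq_coe_nnreal p₁.2.1]; rfl
  have h0 : ENNReal.ofReal (p₀ : ℝ) = (unitInterval.toNNReal (unitInterval.symm p₁) : ENNReal) := by
    have : (p₀ : ℝ) = (unitInterval.symm p₁ : ℝ) := by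
      rw [unitInterval.coe_symm_eq]; linarith
    rw [this, ENNReal.ofReal_eq_coe_nnreal (unitInterval.symm p₁).2.1]; rfl
  rw [h0, h1]
  rfl

/-- The right side is |σ²/(p₀p₁) − 1|, so bounds proportional to |λ| take the required form. -/
lemma abs_le_mul_abs_div_one_sub {lam : ℝ} (hl : |lam| ≤ 1 / 100) :
    |lam| ≤ |2 * lam / (1 - lam)| := by
  obtain ⟨h1, h2⟩ := abs_le.1 hl
  rw [abs_div, abs_mul, abs_of_pos (by linarith : (0:ℝ) < 1 - lam), le_div_iff₀ (by linarith)]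
  norm_num
  nlinarith [abs_nonneg lam]

/-- The label sums of a sticky walk form a discrete normal family. -/
theorem isDiscreteNormalFamily_walkPoly (p₀ p₁ : I) (hp : (p₀ : ℝ) + p₁ = 1) (hp₀ : 0 < (p₀ : ℝ))
    (hp₁ : 0 < (p₁ : ℝ)) {σsq lam : ℝ} (hl : |lam| ≤ 1 / 100)
    (hσ : σsq = p₀ * p₁ * ((1 + lam) / (1 - lam)))
    (hT : IsRandomWalkMatrix (stickyTransition p₀ p₁ lam)) :
    IsDiscreteNormalFamily p₀ p₁ σsq 2 2020 2020
      fun t => polyMeasure (walkPoly p₀ p₁ lam t) := by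
  obtain ⟨hl1, hl2⟩ := abs_le.1 hl
  have hl0 : (0:ℝ) < 1 - lam := by linarith
  have hne : lam ≠ 1 := by linarith
  have hpq0 : 0 < (p₀ : ℝ) * p₁ := mul_pos hp₀ hp₁
  have hnn := walkPoly_coeff_nonneg hp hp₀.le hp₁.le hT
  have hone := fun t => (gapPoly_eval_one (p := (p₀:ℝ)) (q := p₁) hp hne t).2
  have hσ1 : σsq / (p₀ * p₁) - 1 = 2 * lam / (1 - lam) := by
    rw [hσ]; field_simp; ring
  have hσ2 : σsq - p₀ * p₁ = p₀ * p₁ * (2 * lam / (1 - lam)) := by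
    rw [hσ]; field_simp; ring
  have hδ := abs_le_mul_abs_div_one_sub hl
  refine ⟨fun t _ => isProbabilityMeasure_polyMeasure (hnn t) (hone t),
    fun t _ => memLp_polyMeasure _, fun t _ => ?_, fun t ht => ?_, ?_, ?_, ?_, ?_⟩
  · rw [integral_id_polyMeasure (hnn t), walkPoly_derivative_eval_one hp hne]
  · rw [variance_polyMeasure (hnn t) (hone t), walkPoly_derivative_eval_one hp hne,
      walkPoly_variance hp hne, hσ2]
    have e : (p₀ * p₁ * (t * (1 + lam) / (1 - lam) - 2 * lam * (1 - lam ^ t) / (1 - lam) ^ 2)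
        - σsq * t : ℝ) = p₀ * p₁ * (2 * lam / (1 - lam)) * (-((1 - lam ^ t) / (1 - lam))) := by
      rw [hσ]; field_simp; ring
    rw [e, abs_mul, abs_neg, mul_comm]
    refine mul_le_mul_of_nonneg_right ?_ (abs_nonneg _)
    -- This uses t ≥ 1; then (1 − λ^t)/(1 − λ) ≤ 101/99 ≤ 2.
    have hpow : |lam ^ t| ≤ 1 / 100 := by
      rw [abs_pow]
      exact (pow_le_of_le_one (abs_nonneg _) (by linarith) (by omega)).trans hl
    obtain ⟨h1, h2⟩ := abs_le.1 hpow
    rw [abs_of_nonneg (div_nonneg (by linarith) hl0.le), div_le_iff₀ hl0]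
    linarith
  · rw [walkPoly_one, polyMeasure_bernPoly p₀ p₁ hp]
  · intro t ht ℓ s hℓ _ hs hst
    obtain ⟨k, rfl⟩ : ∃ k, ℓ = k + 1 := ⟨ℓ - 1, by omega⟩
    rw [indepSum_polyMeasure fun i j => hnn (s i) j,
      tvDist_polyMeasure (coeff_prod_nonneg _ fun i j => hnn (s i) j) (hnn t), hσ1]
    have h := wnorm_prod_walkPoly_sub_le hp₀ hp₁ hp hl s hs (n := 0) (h := 1) (by
      simpa using! Dominated.one hp₀ hp₁ hp one_pos)
    have hst' : ∑ i, (s i : ℝ) = t := by exact_mod_cast hst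
    rw [one_mul, hst, hst'] at h
    have ht0 : (0:ℝ) < t := by exact_mod_cast ht
    calc 1 / 2 * wnorm 1 (∏ i, walkPoly p₀ p₁ lam (s i) - walkPoly p₀ p₁ lam t)
        ≤ 1 / 2 * (k * (|lam| * (96 / ((0 : ℕ) + t)))) := by gcongr
      _ = 48 * (k * |lam| / t) := by push_cast; ring
      _ ≤ 2020 / 2 * (k * |2 * lam / (1 - lam)| / t) := by gcongr; norm_num
      _ = _ := by push_cast; ring
  · intro t ht a ha
    have hrw : ∀ j : ℤ, |(polyMeasure (walkPoly p₀ p₁ lam t)).real {j}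
        - ((binomial t p₁).map (Nat.cast : ℕ → ℤ)).real {j}|
        = if 0 ≤ j then |(walkPoly p₀ p₁ lam t - bernPoly p₀ p₁ ^ t).coeff j.toNat| else 0 := by
      intro j
      have e : (1 - p₁ : ℝ) = p₀ := by linarith
      rw [polyMeasure_real_singleton (hnn t), map_cast_binomial_real, e, coeff_sub]
      split_ifs <;> simp
    simp only [hrw, hσ1]
    refine (tsum_subtype {j : ℤ | a ≤ |(j : ℝ) - p₁ * t|} fun j : ℤ => if 0 ≤ j then
      |(walkPoly p₀ p₁ lam t - bernPoly p₀ p₁ ^ t).coeff j.toNat| else 0).trans_le ?_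
    rw [tsum_int_eq_sum (N := t + 1)]
    · have h := sum_tail_le (lam := lam) hp₀ hp₁ hp hl ht ha
      rw [Finset.sum_filter] at h
      have h2 : 96 * |lam| * Real.exp (-a ^ 2 / (8 * t))
          ≤ 2020 * |2 * lam / (1 - lam)| * Real.exp (-a ^ 2 / (8 * t)) := by gcongr; norm_num
      refine le_trans (le_of_eq (Finset.sum_congr rfl fun j _ => ?_)) (h.trans h2)
      simp [Set.indicator_apply]
    · intro j hj
      simp [Set.indicator_apply, not_le.2 hj]
    · intro j hj
      have h1 : (walkPoly p₀ p₁ lam t - bernPoly p₀ p₁ ^ t).coeff j = 0 :=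
        coeff_eq_zero_of_natDegree_lt (((natDegree_sub_le _ _).trans
          (max_le (natDegree_walkPoly_le t) (natDegree_bernPoly_pow_le _ _ t))).trans_lt
          (by omega))
      rw [Set.indicator_apply]
      split_ifs
      · simpa using h1
      · rfl
      · rfl
  · intro t _ θ hθ
    rw [integral_exp_polyMeasure (hnn t)]
    exact norm_aeval_walkPoly_le hp₀ hp₁ hp hl hθ t

end DiscreteNormal

theorem proposition2p9 (p₀ p₁ : unitInterval) (hp : (p₀ : ℝ) + (p₁ : ℝ) = 1)
    (hp₀ : 0 < (p₀ : ℝ)) (hp₁ : 0 < (p₁ : ℝ)) (σsq : ℝ)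
    (hlow : (1 - min ((p₀ : ℝ) / p₁) (min ((p₁ : ℝ) / p₀) (1 / 100)))
        / (1 + min ((p₀ : ℝ) / p₁) (min ((p₁ : ℝ) / p₀) (1 / 100))) * (p₀ * p₁) ≤ σsq)
    (hhigh : σsq ≤ (1 + 1 / 100) / (1 - 1 / 100) * ((p₀ : ℝ) * p₁))
    (lam : ℝ) (hlam : lam = (σsq - p₀ * p₁) / (σsq + p₀ * p₁)) :
    ∃ N : ℕ → MeasureTheory.Measure ℤ,
      IsDiscreteNormalFamily p₀ p₁ σsq 2 2020 2020 N ∧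
      -- `N t` is the label sum of the two-state sticky walk started from the distribution `p`
      (∃ hW : IsRandomWalkMatrix (stickyTransition p₀ p₁ lam),
        ∀ t : ℕ, N t = labelSumLaw (labelLaw p₁) (stickyTransition p₀ p₁ lam) hW id t) ∧
      -- and of the sticky walk on every labelled vertex set with label weights `p`
      (∀ (V : Type*) [Fintype V] [Nonempty V] (val : V → Fin 2),
        labelWeight val 0 = p₀ → labelWeight val 1 = p₁ →
        ∃ hG : IsRandomWalkMatrix (stickyMatrix val lam),
          ∀ t : ℕ, N t =
            labelSumLaw (PMF.uniformOfFintype V) (stickyMatrix val lam) hG val t) := by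
  have hpq0 : 0 < (p₀ : ℝ) * p₁ := mul_pos hp₀ hp₁
  set m := min ((p₀ : ℝ) / p₁) (min ((p₁ : ℝ) / p₀) (1 / 100)) with hm
  have hm0 : 0 < m := lt_min (by positivity) (lt_min (by positivity) (by norm_num))
  have hm1 : m ≤ p₀ / p₁ := min_le_left _ _
  have hm2 : m ≤ p₁ / p₀ := (min_le_right _ _).trans (min_le_left _ _)
  have hm3 : m ≤ 1 / 100 := (min_le_right _ _).trans (min_le_right _ _)
  rw [le_div_iff₀ hp₁] at hm1
  rw [le_div_iff₀ hp₀] at hm2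
  rw [div_mul_eq_mul_div, div_le_iff₀ (by positivity)] at hlow
  have hσ0 : 0 < σsq := by
    have : 0 < (1 - m) * ((p₀ : ℝ) * p₁) := mul_pos (by linarith) hpq0
    exact pos_of_mul_pos_left (this.trans_le hlow) (by positivity)
  have hden : 0 < σsq + p₀ * p₁ := by positivity
  have hlow' : -m ≤ lam := by
    rw [hlam, le_div_iff₀ hden]; linarith
  have hhigh' : lam ≤ 1 / 100 := by
    rw [hlam, div_le_iff₀ hden]; linarith
  have hl : |lam| ≤ 1 / 100 := abs_le.2 ⟨by linarith, hhigh'⟩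
  have hσ : σsq = p₀ * p₁ * ((1 + lam) / (1 - lam)) := by
    have h1 : 1 - lam ≠ 0 := by linarith
    have h2 : lam * (σsq + p₀ * p₁) = σsq - p₀ * p₁ := by
      rw [hlam]; field_simp
    field_simp
    linarith
  -- For negative λ the diagonal entries stay nonnegative because λ ≥ −m with mp₁ ≤ p₀ and mp₀ ≤ p₁.
  have hT : IsRandomWalkMatrix (stickyTransition p₀ p₁ lam) :=
    isRandomWalkMatrix_stickyTransition hp hp₀.le hp₁.le (by linarith) (by nlinarith)
      (by nlinarith)
  refine ⟨fun t => polyMeasure (walkPoly p₀ p₁ lam t),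
    isDiscreteNormalFamily_walkPoly p₀ p₁ hp hp₀ hp₁ hl hσ hT, ⟨hT, fun t => ?_⟩, ?_⟩
  · refine (labelSumLaw_eq_polyMeasure (labelLaw p₁) _ hT id hp hp₀.le hp₁.le hT ?_ ?_ t).symm
    · have e : (1 - p₁ : ℝ) = p₀ := by linarith
      intro b
      fin_cases b <;> simp [Finset.filter_eq', labelLaw, e]
    · intro v b
      simp [Finset.filter_eq']
  · intro V _ _ val h0 h1
    have hw : ∀ b, 0 < labelWeight val b := fun b => by
      fin_cases b
      · simpa [h0] using hp₀
      · simpa [h1] using hp₁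
    have hG : IsRandomWalkMatrix (stickyMatrix val lam) :=
      isRandomWalkMatrix_stickyMatrix val hw (by rw [h0, h1, hp]) (by rwa [h0, h1])
    refine ⟨hG, fun t => (labelSumLaw_eq_polyMeasure _ _ hG val hp hp₀.le hp₁.le hT ?_ ?_ t).symm⟩
    · intro b
      rw [sum_uniformOfFintype_fiber]
      fin_cases b <;> simp [h0, h1]
    · intro v b
      rw [sum_stickyMatrix_fiber val hw, h0, h1]
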